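/- **Theorem.** Let $a\in(0,1/2)$, let $\beta=\log_2(2-a)$, $L=\frac{a}{1-a}$, let $\mathbb D$ be the open unit disk, let $\mathcal J$ be the Julia set of the logistic map $x\mapsto ax(1-x)$ on the Riemann sphere $\mathbb C\cup\{\infty\}$ (the complement of the largest open set on which the iterates are equicontinuous in the chordal metric), and let $\mathrm{ext}(\mathcal J)$ be the connected component of the complement of $\mathcal J$ that contains $\infty$. There is a function $G:\mathbb C\to\mathbb C$ (only its values on $\overline{\mathbb D}$ matter) with the following properties. (i) $G$ is analytic in $\mathbb D$, satisfies $$G(z)^2=a\,G(z^2)\,(1+G(z))\qquad(z\in\mathbb D),$$ and $G$ maps $\mathbb D$ conformally (that is, analytically and injectively) onto $\{-1/x : x\in\mathrm{ext}(\mathcal J)\}$, where $1/\infty=0$. (ii) $G$ is Hölder continuous of exponent $\beta$ on the closed disk: there is a constant $K$ with $|G(z)-G(w)|\le K|z-w|^{\beta}$ for all $z,w\in\overline{\mathbb D}$. (iii) The unit circle is a barrier of singularities of $G$: for no $\zeta$ with $|\zeta|=1$ and no $r>0$ is there an analytic function on the disk $\{|z-\zeta|<r\}$ that coincides with $G$ on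 the part of this disk that lies in $\mathbb D$. There are $\rho,r>0$, a function $\Phi$ analytic in $\{|s|<\rho\}$ with $\Phi(0)=L$ and $\Phi'(0)=1$, and a real-analytic function $\Psi:\mathbb R\to\mathbb R$, periodic of period $\ln 2$, that extends analytically to the strip $|\mathrm{Im}\,u|<\pi/2$, such that for all $z\in\mathbb D$ with $|z-1|<r$ $$G(z)=\Phi\big(\tau\,\Psi(\ln\ln z^{-1})\big),\qquad \tau=(\ln z^{-1})^{\beta},\qquad |\tau\,\Psi(\ln\ln z^{-1})|<\rho$$ (principal branches). Moreover there are complex coefficients $C_{l;k,m}$ ($l\in\mathbb Z$; $k,m\in\mathbb N=\{0,1,2,\dots\}$), with $C_{l;0,m}=0$, and $\delta>0$ such that, with $t=1-z$, $$G(z)=L+\sum_{l\in\mathbb Z}\ \sum_{k,m\in\mathbb N}C_{l;k,m}\,t^{\,2\pi i l/\ln 2+k\beta+m}$$ whenever $0<|t|<\delta$ and $|\arg t|<\delta$; the series converges absolutely, and at a geometric rate: there are $K$ and $q\in[0,1)$, independent of $t$, such that the term with index $(l,k,m)$ has modulus at most $K q^{|l|+k+m}$. -/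

import Mathlib

/-- The chordal distance on the Riemann sphere `ℂ ∪ {∞}`. -/
noncomputable def chordalDist : OnePoint ℂ → OnePoint ℂ → ℝ
  | OnePoint.some z, OnePoint.some w =>
      2 * ‖z - w‖ / (Real.sqrt (1 + ‖z‖ ^ 2) * Real.sqrt (1 + ‖w‖ ^ 2))
  | OnePoint.some z, OnePoint.infty => 2 / Real.sqrt (1 + ‖z‖ ^ 2)
  | OnePoint.infty, OnePoint.some w => 2 / Real.sqrt (1 + ‖w‖ ^ 2)
  | OnePoint.infty, OnePoint.infty => 0

/-- The iterates of `f` are equicontinuous at `x` with respect to the chordal distance. The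
topology of `OnePoint ℂ` is the one induced by the chordal distance. -/
def IteratesEquicontinuousAt (f : OnePoint ℂ → OnePoint ℂ) (x : OnePoint ℂ) : Prop :=
  ∀ ε : ℝ, 0 < ε → ∀ᶠ w in nhds x, ∀ n : ℕ, chordalDist (f^[n] x) (f^[n] w) < ε

/-- The Fatou set: the largest open subset of the sphere on which the iterates of `f` are
equicontinuous. -/
def fatouSet (f : OnePoint ℂ → OnePoint ℂ) : Set (OnePoint ℂ) :=
  ⋃₀ {U | IsOpen U ∧ ∀ x ∈ U, IteratesEquicontinuousAt f x}

/-- The Julia set: the complement of the Fatou set in the sphere. -/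
def juliaSet (f : OnePoint ℂ → OnePoint ℂ) : Set (OnePoint ℂ) :=
  (fatouSet f)ᶜ

/-- The logistic map `x ↦ a x (1 - x)` on the Riemann sphere, with `∞ ↦ ∞`. -/
noncomputable def logisticMap (a : ℝ) : OnePoint ℂ → OnePoint ℂ :=
  OnePoint.map (fun x : ℂ => (a : ℂ) * x * (1 - x))

/-- The exterior of a subset of the sphere: the connected component of its complement that
contains `∞`. -/
def sphereExterior (J : Set (OnePoint ℂ)) : Set (OnePoint ℂ) :=
  connectedComponentIn Jᶜ OnePoint.infty

open Classical in
/-- The reciprocal `x ↦ 1 / x` on the Riemann sphere, with `1 / 0 = ∞` and `1 / ∞ = 0`. -/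
noncomputable def sphereInv : OnePoint ℂ → OnePoint ℂ
  | OnePoint.infty => OnePoint.some (0 : ℂ)
  | OnePoint.some x => if x = 0 then OnePoint.infty else OnePoint.some x⁻¹

/-- The unit circle is a singularity barrier of `f`: around no point of the circle does the
restriction of `f` to the open unit disk continue analytically. -/
def UnitCircleIsSingularityBarrier (f : ℂ → ℂ) : Prop :=
  ∀ ζ ∈ Metric.sphere (0 : ℂ) 1, ∀ r : ℝ, 0 < r →
    ¬ ∃ F : ℂ → ℂ, DifferentiableOn ℂ F (Metric.ball ζ r) ∧
      Set.EqOn F f (Metric.ball ζ r ∩ Metric.ball 0 1)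

/-! Write `a = 2 * (1 - b)` with `3 / 4 < b < 1`. The affine change x = 1/2 - w/a turns the logistic
map into w ↦ w² + b(1 - b), with fixed points b (repelling, multiplier 2b) and 1 - b (attracting,
multiplier a). If w parametrizes the basin of ∞ by the unit disk and w(z²) = w(z)² + b(1 - b), then
G = a / (w - (1 - b)), and β = log₂(2b) measures the multiplier at b against doubling.

Everything rests on one explicit contraction. In the coordinate log w, the inverse branch
`logBranch` preserves the half-plane Re ≥ log b and contracts it by (2b)⁻¹. Hence its iterates
converge uniformly on the closed disk to log(z w(z)), which is `bottcherLog`. Injectivity near 0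
spreads to the disk through z ↦ z². The image contains a neighbourhood of ∞ and is closed under
preimages, so it is the whole basin of ∞ (`image_basinParam`); the basin is therefore connected and
equals the exterior of the Julia set.

With z = exp(-s), squaring becomes doubling of s. Doubling n times brings two points to unit
distance while the contraction gains (2b)ⁿ = 2^(nβ): this is the Hölder bound. At z = 1 a one-sided
derivative κ of s ↦ w(exp(-s)) would satisfy 2κ = 2bκ, hence vanish, against |w(exp(-s))| ≥ b
exp(s). The functional equation carries this obstruction to all roots of unity of order 2ⁿ, which
are dense, and so yields the barrier.

Near z = 1 the Koenigs function of the inverse branch at log b gives a coordinate T with T(2s) = 2b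
T(s) and G(exp(-s)) = Φ(T(s)), Φ analytic; then exp(-βu) T(exp u) has period ln 2. The series in t
comes from expanding Φ in powers of T, each power of the periodic factor in a Fourier series, and
the correction from t to -log(1 - t) in a Taylor series. The exponential decay of the Fourier
coefficients dominates all losses (`exists_expansion`). -/

section Development

open Filter Topology Metric Set

/-! ### The contracting inverse branch -/

/-- In the coordinate `p = log w` at infinity, the inverse branch of `w ↦ w ^ 2 + b * (1 - b)`,
twisted by a parameter `y` in the closed unit disk. -/
noncomputable def logBranch (b : ℝ) (y p : ℂ) : ℂ :=
  (p + Complex.log (1 - (b * (1 - b) : ℝ) * y * Complex.exp (-p))) / 2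

lemma norm_exp_neg_le {r : ℝ} (hr : 0 < r) {p : ℂ} (hp : Real.log r ≤ p.re) :
    ‖Complex.exp (-p)‖ ≤ r⁻¹ := by
  rw [Complex.norm_exp, Complex.neg_re, Real.exp_neg]
  exact inv_anti₀ hr ((Real.log_le_iff_le_exp hr).1 hp)

section Branch

variable {b r : ℝ} {y p : ℂ}

/-- Since x(1 - x) decreases on [1/2, 1], `b * (1 - b) ≤ r * (1 - r)`, and `exp (-p)` costs at most
`r⁻¹`. Two radii are used later: `r = b` gives the sharp rate, while `r = 3 / 4` gives a half-plane
with `log b` in its interior, as the linearization needs. -/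
lemma norm_branch_term_le (hr : 3 / 4 ≤ r) (hrb : r ≤ b) (hb : b < 1) (hy : ‖y‖ ≤ 1)
    (hp : Real.log r ≤ p.re) : ‖(b * (1 - b) : ℝ) * y * Complex.exp (-p)‖ ≤ 1 - r := by
  have h0 : 0 < r := by linarith
  have h1 := norm_exp_neg_le h0 hp
  have h2 : 0 ≤ b * (1 - b) := mul_nonneg (by linarith) (by linarith)
  rw [norm_mul, norm_mul, Complex.norm_real, Real.norm_of_nonneg h2]
  calc b * (1 - b) * ‖y‖ * ‖Complex.exp (-p)‖ ≤ (r * (1 - r)) * 1 * r⁻¹ := by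
        have h3 : b * (1 - b) ≤ r * (1 - r) := by nlinarith
        have h4 : 0 ≤ r * (1 - r) := h2.trans h3
        gcongr
    _ = 1 - r := by field_simp

lemma le_norm_one_sub_branch_term (hr : 3 / 4 ≤ r) (hrb : r ≤ b) (hb : b < 1) (hy : ‖y‖ ≤ 1)
    (hp : Real.log r ≤ p.re) : r ≤ ‖1 - (b * (1 - b) : ℝ) * y * Complex.exp (-p)‖ := by
  have h := norm_branch_term_le hr hrb hb hy hp
  have h2 := norm_sub_norm_le 1 ((b * (1 - b) : ℝ) * y * Complex.exp (-p))
  rw [norm_one] at h2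
  linarith

lemma one_sub_branch_term_mem_slitPlane (hr : 3 / 4 ≤ r) (hrb : r ≤ b) (hb : b < 1)
    (hy : ‖y‖ ≤ 1) (hp : Real.log r ≤ p.re) :
    1 - (b * (1 - b) : ℝ) * y * Complex.exp (-p) ∈ Complex.slitPlane := by
  rw [sub_eq_add_neg]
  apply Complex.mem_slitPlane_of_norm_lt_one
  rw [norm_neg]
  linarith [norm_branch_term_le hr hrb hb hy hp]

/-- The new real part is the mean of `p.re` and the logarithm of a modulus that is at least `r`;
hence the half-plane is invariant. -/
lemma le_re_logBranch (hr : 3 / 4 ≤ r) (hrb : r ≤ b) (hb : b < 1) (hy : ‖y‖ ≤ 1)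
    (hp : Real.log r ≤ p.re) : (p.re + Real.log r) / 2 ≤ (logBranch b y p).re := by
  have h : (logBranch b y p).re = (p.re +
      Real.log ‖1 - (b * (1 - b) : ℝ) * y * Complex.exp (-p)‖) / 2 := by
    rw [logBranch, ← Complex.log_re, ← Complex.add_re]
    exact Complex.div_ofNat_re _ 2
  rw [h]
  have := Real.log_le_log (by linarith) (le_norm_one_sub_branch_term hr hrb hb hy hp)
  linarith

lemma log_le_re_logBranch (hr : 3 / 4 ≤ r) (hrb : r ≤ b) (hb : b < 1) (hy : ‖y‖ ≤ 1)
    (hp : Real.log r ≤ p.re) : Real.log r ≤ (logBranch b y p).re := by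
  linarith [le_re_logBranch hr hrb hb hy hp]

lemma hasDerivAt_logBranch (hr : 3 / 4 ≤ r) (hrb : r ≤ b) (hb : b < 1) (hy : ‖y‖ ≤ 1)
    (hp : Real.log r ≤ p.re) :
    HasDerivAt (logBranch b y)
      (1 / (2 * (1 - (b * (1 - b) : ℝ) * y * Complex.exp (-p)))) p := by
  have hs := one_sub_branch_term_mem_slitPlane hr hrb hb hy hp
  have h0 := Complex.slitPlane_ne_zero hs
  have h1 : HasDerivAt (fun p : ℂ => 1 - (b * (1 - b) : ℝ) * y * Complex.exp (-p))
      ((b * (1 - b) : ℝ) * y * Complex.exp (-p)) p := by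
    have := (((hasDerivAt_neg p).cexp).const_mul (((b * (1 - b) : ℝ) : ℂ) * y)).const_sub 1
    refine this.congr_deriv (by ring)
  refine (((hasDerivAt_id p).add (h1.clog hs)).div_const 2).congr_deriv ?_
  field_simp
  ring

/-- For `r = b` and `y = 1` the bound is attained at the fixed point `log b`; this is what makes the
Hölder exponent `Real.logb 2 (2 * b)` come out. -/
lemma norm_deriv_logBranch_le (hr : 3 / 4 ≤ r) (hrb : r ≤ b) (hb : b < 1) (hy : ‖y‖ ≤ 1)
    (hp : Real.log r ≤ p.re) :
    ‖1 / (2 * (1 - (b * (1 - b) : ℝ) * y * Complex.exp (-p)))‖ ≤ (2 * r)⁻¹ := by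
  have h := le_norm_one_sub_branch_term hr hrb hb hy hp
  rw [norm_div, norm_one, norm_mul, one_div]
  refine inv_anti₀ (by linarith) ?_
  simpa using h

lemma norm_logBranch_sub_le (hr : 3 / 4 ≤ r) (hrb : r ≤ b) (hb : b < 1) (hy : ‖y‖ ≤ 1)
    {p q : ℂ} (hp : Real.log r ≤ p.re) (hq : Real.log r ≤ q.re) :
    ‖logBranch b y p - logBranch b y q‖ ≤ (2 * r)⁻¹ * ‖p - q‖ :=
  Convex.norm_image_sub_le_of_norm_hasDerivWithin_le
    (s := {p : ℂ | Real.log r ≤ p.re})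
    (fun _ hx => (hasDerivAt_logBranch hr hrb hb hy hx).hasDerivWithinAt)
    (fun _ hx => norm_deriv_logBranch_le hr hrb hb hy hx) (convex_halfSpace_re_ge _) hq hp

lemma exp_neg_two_mul_logBranch
    (h : 1 - (b * (1 - b) : ℝ) * y * Complex.exp (-p) ≠ 0) :
    Complex.exp (-(2 * logBranch b y p)) * (1 - (b * (1 - b) : ℝ) * y * Complex.exp (-p)) =
      Complex.exp (-p) := by
  have : -(2 * logBranch b y p) =
      -p - Complex.log (1 - (b * (1 - b) : ℝ) * y * Complex.exp (-p)) := by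
    rw [logBranch]; ring
  rw [this, Complex.exp_sub, Complex.exp_log h, div_mul_cancel₀ _ h]

/-- The shift by `s` absorbs the twist, so the recursion for `bottcherLog` becomes iteration of the
single map `logBranch b 1`. -/
lemma add_logBranch_exp (b : ℝ) (s p : ℂ) :
    s + logBranch b (Complex.exp (-(2 * s))) p = logBranch b 1 (2 * s + p) := by
  simp only [logBranch, neg_add, Complex.exp_add, mul_one, mul_assoc]
  ring

end Branch

/-! ### The inverse Böttcher coordinate -/

/-- The successive approximations of the logarithm of `w z * z`, where `w` is the inverse
Böttcher coordinate. -/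
noncomputable def bottcherApprox (b : ℝ) : ℕ → ℂ → ℂ
  | 0, _ => 0
  | n + 1, z => logBranch b (z ^ 2) (bottcherApprox b n (z ^ 2))

section Bottcher

variable {b : ℝ}

lemma log_le_re_bottcherApprox (hb : 3 / 4 < b) (hb1 : b < 1) (n : ℕ) :
    ∀ {z : ℂ}, ‖z‖ ≤ 1 → Real.log b ≤ (bottcherApprox b n z).re := by
  induction n with
  | zero => intro z _; simpa [bottcherApprox] using Real.log_nonpos (by linarith) hb1.le
  | succ n ih =>
    intro z hz
    have hz2 : ‖z ^ 2‖ ≤ 1 := by rw [norm_pow]; exact pow_le_one₀ (norm_nonneg _) hz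
    exact log_le_re_logBranch hb.le le_rfl hb1 hz2 (ih hz2)

/-- Consecutive approximations at `z` are the images of consecutive approximations at `z ^ 2` under
one and the same contraction. -/
lemma norm_bottcherApprox_succ_sub_le (hb : 3 / 4 < b) (hb1 : b < 1) (n : ℕ) :
    ∀ {z : ℂ}, ‖z‖ ≤ 1 →
      ‖bottcherApprox b n z - bottcherApprox b (n + 1) z‖ ≤ 3 / 4 * ((2 * b)⁻¹) ^ n := by
  induction n with
  | zero =>
    intro z hz
    have hz2 : ‖z ^ 2‖ ≤ 1 := by rw [norm_pow]; exact pow_le_one₀ (norm_nonneg _) hz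
    have h := norm_branch_term_le (p := 0) hb.le le_rfl hb1 hz2
      (by simpa using Real.log_nonpos (by linarith) hb1.le)
    rw [neg_zero, Complex.exp_zero, mul_one] at h
    have h2 := Complex.norm_log_one_add_half_le_self
      (z := -((b * (1 - b) : ℝ) * z ^ 2)) (by rw [norm_neg]; linarith)
    rw [norm_neg, ← sub_eq_add_neg] at h2
    simp only [bottcherApprox, logBranch, zero_sub, zero_add, norm_neg, norm_div, pow_zero,
      RCLike.norm_ofNat, neg_zero, Complex.exp_zero, mul_one]
    linarith
  | succ n ih =>
    intro z hz
    have hz2 : ‖z ^ 2‖ ≤ 1 := by rw [norm_pow]; exact pow_le_one₀ (norm_nonneg _) hz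
    have h := norm_logBranch_sub_le hb.le le_rfl hb1 hz2
      (log_le_re_bottcherApprox hb hb1 n hz2) (log_le_re_bottcherApprox hb hb1 (n + 1) hz2)
    calc _ ≤ (2 * b)⁻¹ * (3 / 4 * ((2 * b)⁻¹) ^ n) :=
          h.trans (mul_le_mul_of_nonneg_left (ih hz2) (by positivity))
      _ = _ := by ring

/-- The logarithm of `w z * z`, where `w` is the inverse Böttcher coordinate. -/
noncomputable def bottcherLog (b : ℝ) (z : ℂ) : ℂ :=
  limUnder atTop (fun n => bottcherApprox b n z)

lemma inv_two_mul_lt_one (hb : 3 / 4 < b) : (2 * b)⁻¹ < 1 :=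
  inv_lt_one_of_one_lt₀ (by linarith)

lemma tendsto_bottcherApprox (hb : 3 / 4 < b) (hb1 : b < 1) {z : ℂ} (hz : ‖z‖ ≤ 1) :
    Tendsto (fun n => bottcherApprox b n z) atTop (𝓝 (bottcherLog b z)) := by
  refine CauchySeq.tendsto_limUnder (cauchySeq_of_le_geometric _ (3 / 4)
    (inv_two_mul_lt_one hb) fun n => ?_)
  rw [dist_eq_norm]
  exact norm_bottcherApprox_succ_sub_le hb hb1 n hz

lemma dist_bottcherApprox_le (hb : 3 / 4 < b) (hb1 : b < 1) {z : ℂ} (hz : ‖z‖ ≤ 1) (n : ℕ) :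
    dist (bottcherApprox b n z) (bottcherLog b z) ≤
      3 / 4 * ((2 * b)⁻¹) ^ n / (1 - (2 * b)⁻¹) := by
  refine dist_le_of_le_geometric_of_tendsto _ _ (inv_two_mul_lt_one hb) (fun n => ?_)
    (tendsto_bottcherApprox hb hb1 hz) n
  rw [dist_eq_norm]
  exact norm_bottcherApprox_succ_sub_le hb hb1 n hz

lemma norm_bottcherLog_le (hb : 3 / 4 < b) (hb1 : b < 1) {z : ℂ} (hz : ‖z‖ ≤ 1) :
    ‖bottcherLog b z‖ ≤ 9 / 4 := by
  have h := dist_bottcherApprox_le hb hb1 hz 0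
  rw [bottcherApprox, dist_zero_left, pow_zero, mul_one] at h
  refine h.trans ?_
  -- The geometric sum is at most (3/4) / (1 - 2/3) = 9/4.
  have : (2 * b)⁻¹ ≤ 2 / 3 := by
    rw [show (2 / 3 : ℝ) = (3 / 2)⁻¹ by norm_num]
    exact inv_anti₀ (by norm_num) (by linarith)
  rw [div_le_iff₀ (by linarith)]
  linarith

lemma log_le_re_bottcherLog (hb : 3 / 4 < b) (hb1 : b < 1) {z : ℂ} (hz : ‖z‖ ≤ 1) :
    Real.log b ≤ (bottcherLog b z).re :=
  ge_of_tendsto' ((Complex.continuous_re.tendsto _).comp (tendsto_bottcherApprox hb hb1 hz))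
    fun n => log_le_re_bottcherApprox hb hb1 n hz

lemma tendstoUniformlyOn_bottcherApprox (hb : 3 / 4 < b) (hb1 : b < 1) :
    TendstoUniformlyOn (bottcherApprox b) (bottcherLog b) atTop (closedBall 0 1) := by
  rw [Metric.tendstoUniformlyOn_iff]
  intro ε hε
  have h : Tendsto (fun n : ℕ => 3 / 4 * ((2 * b)⁻¹) ^ n / (1 - (2 * b)⁻¹)) atTop (𝓝 0) := by
    have := ((tendsto_pow_atTop_nhds_zero_of_lt_one (by positivity)
      (inv_two_mul_lt_one hb)).const_mul (3 / 4)).div_const (1 - (2 * b)⁻¹)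
    simpa using this
  filter_upwards [h.eventually_lt_const hε] with n hn z hz
  rw [dist_comm]
  exact (dist_bottcherApprox_le hb hb1 (by simpa using hz) n).trans_lt hn

lemma norm_sq_le_one {z : ℂ} (hz : ‖z‖ ≤ 1) : ‖z ^ 2‖ ≤ 1 := by
  rw [norm_pow]; exact pow_le_one₀ (norm_nonneg _) hz

lemma norm_sq_lt_one {z : ℂ} (hz : ‖z‖ < 1) : ‖z ^ 2‖ < 1 := by
  rw [norm_pow]; exact pow_lt_one₀ (norm_nonneg _) hz two_ne_zero

lemma continuousOn_bottcherApprox (hb : 3 / 4 < b) (hb1 : b < 1) (n : ℕ) :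
    ContinuousOn (bottcherApprox b n) (closedBall 0 1) := by
  induction n with
  | zero => exact continuousOn_const
  | succ n ih =>
    have h2 : ContinuousOn (fun z : ℂ => bottcherApprox b n (z ^ 2)) (closedBall 0 1) :=
      ih.comp (by fun_prop) fun z hz => by simpa using norm_sq_le_one (by simpa using hz)
    refine (h2.add (ContinuousOn.clog ?_ fun z hz => ?_)).div_const 2
    · exact continuousOn_const.sub
        ((continuousOn_const.mul (by fun_prop)).mul h2.neg.cexp)
    · have hz2 := norm_sq_le_one (z := z) (by simpa using hz)
      exact one_sub_branch_term_mem_slitPlane hb.le le_rfl hb1 hz2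
        (log_le_re_bottcherApprox hb hb1 n hz2)

lemma differentiableOn_bottcherApprox (hb : 3 / 4 < b) (hb1 : b < 1) (n : ℕ) :
    DifferentiableOn ℂ (bottcherApprox b n) (ball 0 1) := by
  induction n with
  | zero => exact differentiableOn_const _
  | succ n ih =>
    have h2 : DifferentiableOn ℂ (fun z : ℂ => bottcherApprox b n (z ^ 2)) (ball 0 1) :=
      ih.comp (by fun_prop) fun z hz => by simpa using norm_sq_lt_one (by simpa using hz)
    refine (h2.add (DifferentiableOn.clog ?_ fun z hz => ?_)).div_const 2
    · exact (differentiableOn_const _).sub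
        (((differentiableOn_const _).mul (by fun_prop)).mul h2.neg.cexp)
    · have hz2 := norm_sq_le_one (z := z) (by simpa using (mem_ball_zero_iff.1 hz).le)
      exact one_sub_branch_term_mem_slitPlane hb.le le_rfl hb1 hz2
        (log_le_re_bottcherApprox hb hb1 n hz2)

lemma continuousOn_bottcherLog (hb : 3 / 4 < b) (hb1 : b < 1) :
    ContinuousOn (bottcherLog b) (closedBall 0 1) :=
  (tendstoUniformlyOn_bottcherApprox hb hb1).continuousOn
    (Frequently.of_forall (continuousOn_bottcherApprox hb hb1))

lemma differentiableOn_bottcherLog (hb : 3 / 4 < b) (hb1 : b < 1) :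
    DifferentiableOn ℂ (bottcherLog b) (ball 0 1) :=
  ((tendstoUniformlyOn_bottcherApprox hb hb1).mono
    ball_subset_closedBall).tendstoLocallyUniformlyOn.differentiableOn
    (Eventually.of_forall (differentiableOn_bottcherApprox hb hb1)) isOpen_ball

lemma bottcherLog_eq (hb : 3 / 4 < b) (hb1 : b < 1) {z : ℂ} (hz : ‖z‖ ≤ 1) :
    bottcherLog b z = logBranch b (z ^ 2) (bottcherLog b (z ^ 2)) := by
  have hz2 := norm_sq_le_one hz
  have h1 := (tendsto_bottcherApprox hb hb1 hz).comp (tendsto_add_atTop_nat 1)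
  have h2 := (hasDerivAt_logBranch hb.le le_rfl hb1 hz2
    (log_le_re_bottcherLog hb hb1 hz2)).continuousAt.tendsto.comp
    (tendsto_bottcherApprox hb hb1 hz2)
  exact tendsto_nhds_unique h1 h2

lemma bottcherLog_neg (hb : 3 / 4 < b) (hb1 : b < 1) {z : ℂ} (hz : ‖z‖ ≤ 1) :
    bottcherLog b (-z) = bottcherLog b z := by
  rw [bottcherLog_eq hb hb1 (z := -z) (by simpa using hz), neg_sq, ← bottcherLog_eq hb hb1 hz]

lemma bottcherApprox_zero (b : ℝ) (n : ℕ) : bottcherApprox b n 0 = 0 := by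
  induction n with
  | zero => rfl
  | succ n ih => simp [bottcherApprox, logBranch, ih]

lemma bottcherLog_zero (hb : 3 / 4 < b) (hb1 : b < 1) : bottcherLog b 0 = 0 := by
  refine tendsto_nhds_unique (tendsto_bottcherApprox hb hb1 (z := 0) (by simp)) ?_
  simp [bottcherApprox_zero]

/-- The reciprocal of the inverse Böttcher coordinate of `w ↦ w ^ 2 + b * (1 - b)`. -/
noncomputable def bottcherInv (b : ℝ) (z : ℂ) : ℂ :=
  z * Complex.exp (-bottcherLog b z)

lemma norm_bottcherInv_le (hb : 3 / 4 < b) (hb1 : b < 1) {z : ℂ} (hz : ‖z‖ ≤ 1) :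
    ‖bottcherInv b z‖ ≤ ‖z‖ / b := by
  rw [bottcherInv, norm_mul, div_eq_mul_inv]
  exact mul_le_mul_of_nonneg_left (norm_exp_neg_le (by linarith)
    (log_le_re_bottcherLog hb hb1 hz)) (norm_nonneg _)

lemma norm_bottcherInv_le_four_thirds (hb : 3 / 4 < b) (hb1 : b < 1) {z : ℂ} (hz : ‖z‖ ≤ 1) :
    ‖bottcherInv b z‖ ≤ 4 / 3 := by
  refine (norm_bottcherInv_le hb hb1 hz).trans ?_
  rw [div_le_iff₀ (by linarith)]
  linarith

/-- This is w(z²) = w(z)² + b(1 - b) for w = 1 / `bottcherInv`, cleared of denominators so that `z =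
0` is included. -/
lemma bottcherInv_sq (hb : 3 / 4 < b) (hb1 : b < 1) {z : ℂ} (hz : ‖z‖ ≤ 1) :
    bottcherInv b z ^ 2 * (1 - (b * (1 - b) : ℝ) * bottcherInv b (z ^ 2)) =
      bottcherInv b (z ^ 2) := by
  have hz2 := norm_sq_le_one hz
  have h := exp_neg_two_mul_logBranch (b := b) (y := z ^ 2) (p := bottcherLog b (z ^ 2))
    (Complex.slitPlane_ne_zero (one_sub_branch_term_mem_slitPlane hb.le le_rfl hb1 hz2
        (log_le_re_bottcherLog hb hb1 hz2)))
  rw [← bottcherLog_eq hb hb1 hz] at h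
  have h3 : Complex.exp (-bottcherLog b z) ^ 2 = Complex.exp (-(2 * bottcherLog b z)) := by
    rw [← Complex.exp_nat_mul]; congr 1; push_cast; ring
  rw [bottcherInv, bottcherInv, mul_pow, h3, ← mul_assoc, mul_assoc (z ^ 2), h]

lemma bottcherInv_neg (hb : 3 / 4 < b) (hb1 : b < 1) {z : ℂ} (hz : ‖z‖ ≤ 1) :
    bottcherInv b (-z) = -bottcherInv b z := by
  rw [bottcherInv, bottcherLog_neg hb hb1 hz, bottcherInv, neg_mul]

lemma bottcherInv_eq_zero_iff {z : ℂ} : bottcherInv b z = 0 ↔ z = 0 := by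
  simp [bottcherInv, Complex.exp_ne_zero]

lemma continuousOn_bottcherInv (hb : 3 / 4 < b) (hb1 : b < 1) :
    ContinuousOn (bottcherInv b) (closedBall 0 1) :=
  continuousOn_id.mul (continuousOn_bottcherLog hb hb1).neg.cexp

lemma differentiableOn_bottcherInv (hb : 3 / 4 < b) (hb1 : b < 1) :
    DifferentiableOn ℂ (bottcherInv b) (ball 0 1) :=
  differentiableOn_id.mul (differentiableOn_bottcherLog hb hb1).neg.cexp

lemma hasStrictDerivAt_bottcherInv_zero (hb : 3 / 4 < b) (hb1 : b < 1) :
    HasStrictDerivAt (bottcherInv b) 1 0 := by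
  have han : AnalyticAt ℂ (bottcherInv b) 0 :=
    (differentiableOn_bottcherInv hb hb1).analyticAt (ball_mem_nhds 0 one_pos)
  have hd : HasDerivAt (bottcherInv b) 1 0 := by
    have h1 := ((differentiableOn_bottcherLog hb hb1).differentiableAt
      (ball_mem_nhds 0 one_pos)).hasDerivAt
    refine ((hasDerivAt_id (0 : ℂ)).mul h1.neg.cexp).congr_deriv ?_
    simp [bottcherLog_zero hb hb1]
  simpa [hd.deriv] using han.hasStrictDerivAt

/-- Equal values at `z` and `w` give equal values at their squares, and after enough squarings both
points lie where the inverse function theorem applies. On the way back, `z ^ 2 = w ^ 2` leaves only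
`z = w` or `z = -w`, and oddness excludes the latter unless both vanish. -/
lemma bottcherInv_injOn (hb : 3 / 4 < b) (hb1 : b < 1) :
    InjOn (bottcherInv b) (ball 0 1) := by
  have hs := hasStrictDerivAt_bottcherInv_zero hb hb1
  obtain ⟨U, hU, hUi⟩ : ∃ U ∈ 𝓝 (0 : ℂ), InjOn (bottcherInv b) U := by
    have hs' : HasStrictFDerivAt (bottcherInv b)
        ((ContinuousLinearEquiv.unitsEquivAut ℂ (Units.mk0 1 one_ne_zero) : ℂ ≃L[ℂ] ℂ) :
          ℂ →L[ℂ] ℂ) 0 := hs.hasStrictFDerivAt_equiv one_ne_zero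
    exact ⟨_, (hs'.toOpenPartialHomeomorph _).open_source.mem_nhds
      hs'.mem_toOpenPartialHomeomorph_source, (hs'.toOpenPartialHomeomorph _).injOn⟩
  have key : ∀ n : ℕ, ∀ z w : ℂ, ‖z‖ < 1 → ‖w‖ < 1 → bottcherInv b z = bottcherInv b w →
      z ^ 2 ^ n ∈ U → w ^ 2 ^ n ∈ U → z = w := by
    intro n
    induction n with
    | zero => intro z w _ _ h hzU hwU; exact hUi (by simpa using hzU) (by simpa using hwU) h
    | succ n ih =>
      intro z w hz hw h hzU hwU
      have hsq : bottcherInv b (z ^ 2) = bottcherInv b (w ^ 2) := by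
        have h1 := bottcherInv_sq hb hb1 hz.le
        have h2 := bottcherInv_sq hb hb1 hw.le
        rw [h] at h1
        -- If this factor were 0, `h2` would force `bottcherInv b w ^ 2 = 0`, and the factor would
        -- be 1.
        have hne : 1 + (b * (1 - b) : ℝ) * bottcherInv b w ^ 2 ≠ 0 := by
          intro h0
          have h4 : bottcherInv b w ^ 2 = 0 := by
            linear_combination (bottcherInv b (w ^ 2)) * h0 + h2
          rw [h4] at h0
          simp at h0
        have : (1 + (b * (1 - b) : ℝ) * bottcherInv b w ^ 2) *
            (bottcherInv b (z ^ 2) - bottcherInv b (w ^ 2)) = 0 := by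
          linear_combination h2 - h1
        exact sub_eq_zero.1 ((mul_eq_zero.1 this).resolve_left hne)
      have h5 := ih (z ^ 2) (w ^ 2) (norm_sq_lt_one hz) (norm_sq_lt_one hw) hsq
        (by rw [← pow_mul, ← pow_succ']; exact hzU) (by rw [← pow_mul, ← pow_succ']; exact hwU)
      rcases sq_eq_sq_iff_eq_or_eq_neg.1 h5 with h6 | h6
      · exact h6
      · rw [h6, bottcherInv_neg hb hb1 hw.le] at h
        have h7 : bottcherInv b w = 0 := by linear_combination -h / 2
        rw [bottcherInv_eq_zero_iff] at h7
        rw [h6, h7, neg_zero]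
  intro z hz w hw h
  rw [mem_ball_zero_iff] at hz hw
  have ht : ∀ {z : ℂ}, ‖z‖ < 1 → ∀ᶠ n : ℕ in atTop, z ^ 2 ^ n ∈ U := fun hz =>
    ((tendsto_pow_atTop_nhds_zero_of_norm_lt_one hz).comp
      (tendsto_pow_atTop_atTop_of_one_lt one_lt_two)).eventually hU
  obtain ⟨n, h1, h2⟩ := ((ht hz).and (ht hw)).exists
  exact key n z w hz hw h h1 h2

end Bottcher

/-! ### The conformal map and its functional equation -/

/-- The conjugacy `G`, obtained from the inverse Böttcher coordinate by a Möbius map. -/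
noncomputable def conjMap (b : ℝ) (z : ℂ) : ℂ :=
  (2 * (1 - b) : ℝ) * bottcherInv b z / (1 - (1 - b : ℝ) * bottcherInv b z)

section ConjMap

variable {b : ℝ}

lemma two_thirds_le_norm_one_sub {x : ℂ} (hb : 3 / 4 < b) (hb1 : b < 1) (hx : ‖x‖ ≤ 4 / 3) :
    2 / 3 ≤ ‖1 - (1 - b : ℝ) * x‖ := by
  have h2 := norm_sub_norm_le 1 ((1 - b : ℝ) * x)
  rw [norm_one, norm_mul, Complex.norm_real, Real.norm_of_nonneg (by linarith)] at h2
  nlinarith [norm_nonneg x]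

lemma conjMap_denom_ne_zero (hb : 3 / 4 < b) (hb1 : b < 1) {z : ℂ} (hz : ‖z‖ ≤ 1) :
    1 - (1 - b : ℝ) * bottcherInv b z ≠ 0 := by
  have := two_thirds_le_norm_one_sub hb hb1 (norm_bottcherInv_le_four_thirds hb hb1 hz)
  intro h
  rw [h, norm_zero] at this
  linarith

lemma conjMap_denom_ne_zero' (hb : 3 / 4 < b) (hb1 : b < 1) {z : ℂ} (hz : ‖z‖ ≤ 1) :
    1 + (1 - b : ℝ) * bottcherInv b z ≠ 0 := by
  have := conjMap_denom_ne_zero hb hb1 (z := -z) (by simpa using hz)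
  rwa [bottcherInv_neg hb hb1 hz, mul_neg, sub_neg_eq_add] at this

lemma conjMap_eq_zero_iff (hb : 3 / 4 < b) (hb1 : b < 1) {z : ℂ} (hz : ‖z‖ ≤ 1) :
    conjMap b z = 0 ↔ z = 0 := by
  have h : (2 * (1 - b) : ℝ) ≠ 0 := by linarith
  rw [conjMap, div_eq_zero_iff, or_iff_left (conjMap_denom_ne_zero hb hb1 hz), mul_eq_zero,
    or_iff_right (by exact_mod_cast h), bottcherInv_eq_zero_iff]

lemma conjMap_sq (hb : 3 / 4 < b) (hb1 : b < 1) {z : ℂ} (hz : ‖z‖ ≤ 1) :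
    conjMap b z ^ 2 = (2 * (1 - b) : ℝ) * conjMap b (z ^ 2) * (1 + conjMap b z) := by
  have h1 := conjMap_denom_ne_zero hb hb1 hz
  have h2 := conjMap_denom_ne_zero hb hb1 (norm_sq_le_one hz)
  have h3 := bottcherInv_sq hb hb1 hz
  simp only [conjMap]
  push_cast at *
  field_simp
  linear_combination (1 - b : ℂ) ^ 2 * h3

lemma differentiableOn_conjMap (hb : 3 / 4 < b) (hb1 : b < 1) :
    DifferentiableOn ℂ (conjMap b) (ball 0 1) :=
  ((differentiableOn_bottcherInv hb hb1).const_mul _).div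
    (((differentiableOn_bottcherInv hb hb1).const_mul _).const_sub 1)
    fun z hz => conjMap_denom_ne_zero hb hb1 (by simpa using (mem_ball_zero_iff.1 hz).le)

lemma continuousOn_conjMap (hb : 3 / 4 < b) (hb1 : b < 1) :
    ContinuousOn (conjMap b) (closedBall 0 1) :=
  (continuousOn_const.mul (continuousOn_bottcherInv hb hb1)).div
    (continuousOn_const.sub (continuousOn_const.mul (continuousOn_bottcherInv hb hb1)))
    fun z hz => conjMap_denom_ne_zero hb hb1 (by simpa using hz)

lemma injOn_conjMap (hb : 3 / 4 < b) (hb1 : b < 1) : InjOn (conjMap b) (ball 0 1) := by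
  intro z hz w hw h
  apply bottcherInv_injOn hb hb1 hz hw
  have h1 := conjMap_denom_ne_zero hb hb1 (mem_ball_zero_iff.1 hz).le
  have h2 := conjMap_denom_ne_zero hb hb1 (mem_ball_zero_iff.1 hw).le
  have h3 : (2 * (1 - b) : ℂ) ≠ 0 := by
    have : (2 * (1 - b) : ℝ) ≠ 0 := by linarith
    exact_mod_cast this
  rw [conjMap, conjMap, div_eq_div_iff h1 h2] at h
  push_cast at h
  apply mul_left_cancel₀ h3
  linear_combination h

/-- The derivative at 0 is `2 * (1 - b) ≠ 0`, so the map is open there. This makes the basin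
parametrization cover a neighbourhood of ∞. -/
lemma map_nhds_conjMap_zero (hb : 3 / 4 < b) (hb1 : b < 1) :
    map (conjMap b) (𝓝 0) = 𝓝 0 := by
  have h0 : conjMap b 0 = 0 := (conjMap_eq_zero_iff hb hb1 (by simp)).2 rfl
  have hH := hasStrictDerivAt_bottcherInv_zero hb hb1
  have h := ((hH.const_mul ((2 * (1 - b) : ℝ) : ℂ)).div
    ((hH.const_mul ((1 - b : ℝ) : ℂ)).const_sub 1)
    (conjMap_denom_ne_zero hb hb1 (by simp))).map_nhds_eq (by
      have h1 : (2 * (1 - b) : ℂ) ≠ 0 := by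
        have : (2 * (1 - b) : ℝ) ≠ 0 := by linarith
        exact_mod_cast this
      have h2 : bottcherInv b 0 = 0 := bottcherInv_eq_zero_iff.2 rfl
      simpa [h2] using h1)
  have h3 : ((fun z => ((2 * (1 - b) : ℝ) : ℂ) * bottcherInv b z) /
      fun z => 1 - ((1 - b : ℝ) : ℂ) * bottcherInv b z) = conjMap b := rfl
  rwa [h3, h0] at h

end ConjMap

/-! ### Reciprocals and neighbourhoods of infinity on the sphere -/

lemma sphereInv_coe_zero : sphereInv ((0 : ℂ) : OnePoint ℂ) = OnePoint.infty := by
  simp [sphereInv]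

lemma sphereInv_coe {x : ℂ} (hx : x ≠ 0) : sphereInv (x : OnePoint ℂ) = (x⁻¹ : ℂ) := by
  simp [sphereInv, hx]

lemma sphereInv_infty : sphereInv OnePoint.infty = ((0 : ℂ) : OnePoint ℂ) := rfl

lemma sphereInv_involutive : Function.Involutive sphereInv := by
  intro p
  induction p using OnePoint.rec with
  | infty => rw [sphereInv_infty, sphereInv_coe_zero]
  | coe x =>
    by_cases hx : x = 0
    · rw [hx, sphereInv_coe_zero, sphereInv_infty]
    · rw [sphereInv_coe hx, sphereInv_coe (inv_ne_zero hx), inv_inv]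

lemma continuous_sphereInv_coe : Continuous fun x : ℂ => sphereInv (x : OnePoint ℂ) := by
  rw [continuous_iff_continuousAt]
  intro x
  by_cases hx : x = 0
  · subst hx
    rw [ContinuousAt, sphereInv_coe_zero, ← pure_sup_nhdsNE, tendsto_sup]
    refine ⟨?_, ?_⟩
    · rw [tendsto_pure_left]
      intro s hs
      rw [sphereInv_coe_zero]
      exact mem_of_mem_nhds hs
    · have h : Tendsto (fun x : ℂ => ((x⁻¹ : ℂ) : OnePoint ℂ)) (𝓝[≠] 0) (𝓝 OnePoint.infty) := by
        refine OnePoint.tendsto_coe_infty.comp ?_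
        rw [coclosedCompact_eq_cocompact, ← Metric.cobounded_eq_cocompact]
        exact tendsto_inv₀_nhdsNE_zero
      refine h.congr' ?_
      filter_upwards [self_mem_nhdsWithin] with y hy
      exact (sphereInv_coe hy).symm
  · have h : ContinuousAt (fun x : ℂ => ((x⁻¹ : ℂ) : OnePoint ℂ)) x :=
      OnePoint.continuous_coe.continuousAt.comp (continuousAt_inv₀ hx)
    refine h.congr ?_
    filter_upwards [isOpen_ne.mem_nhds hx] with y hy
    exact (sphereInv_coe hy).symm

/-- The complement of a closed disk in the sphere. -/
def outerDisk (R : ℝ) : Set (OnePoint ℂ) := (OnePoint.some '' closedBall (0 : ℂ) R)ᶜ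

lemma isOpen_outerDisk (R : ℝ) : IsOpen (outerDisk R) :=
  OnePoint.isOpen_compl_image_coe.2 ⟨isClosed_closedBall, isCompact_closedBall _ _⟩

lemma infty_mem_outerDisk (R : ℝ) : OnePoint.infty ∈ outerDisk R := by
  simp [outerDisk]

lemma coe_mem_outerDisk {R : ℝ} {x : ℂ} : (x : OnePoint ℂ) ∈ outerDisk R ↔ R < ‖x‖ := by
  simp [outerDisk]

lemma outerDisk_anti {R S : ℝ} (h : R ≤ S) : outerDisk S ⊆ outerDisk R :=
  compl_subset_compl.2 (image_mono (closedBall_subset_closedBall h))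

/-! ### Chordal distance estimates -/

section Chordal

lemma norm_le_sqrt_one_add (z : ℂ) : ‖z‖ ≤ √(1 + ‖z‖ ^ 2) :=
  Real.le_sqrt_of_sq_le (by linarith)

lemma sqrt_one_add_pos (z : ℂ) : 0 < √(1 + ‖z‖ ^ 2) := Real.sqrt_pos.2 (by positivity)

lemma chordalDist_coe_coe (z w : ℂ) : chordalDist (z : OnePoint ℂ) (w : OnePoint ℂ) =
    2 * ‖z - w‖ / (√(1 + ‖z‖ ^ 2) * √(1 + ‖w‖ ^ 2)) := rfl

lemma chordalDist_coe_infty (z : ℂ) : chordalDist (z : OnePoint ℂ) OnePoint.infty =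
    2 / √(1 + ‖z‖ ^ 2) := rfl

lemma chordalDist_infty_coe (z : ℂ) : chordalDist OnePoint.infty (z : OnePoint ℂ) =
    2 / √(1 + ‖z‖ ^ 2) := rfl

lemma chordalDist_infty_infty : chordalDist OnePoint.infty OnePoint.infty = 0 := rfl

lemma two_div_sqrt_le {M : ℝ} (hM : 0 < M) {z : ℂ} (hz : M < ‖z‖) :
    2 / √(1 + ‖z‖ ^ 2) ≤ 2 / M :=
  div_le_div_of_nonneg_left (by norm_num) hM (hz.le.trans (norm_le_sqrt_one_add z))

lemma chordalDist_le_of_mem_outerDisk {M : ℝ} (hM : 0 < M) {p q : OnePoint ℂ}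
    (hp : p ∈ outerDisk M) (hq : q ∈ outerDisk M) : chordalDist p q ≤ 4 / M := by
  have h24 : 2 / M ≤ 4 / M := by gcongr; norm_num
  induction p using OnePoint.rec with
  | infty =>
    induction q using OnePoint.rec with
    | infty => rw [chordalDist_infty_infty]; positivity
    | coe w =>
      rw [coe_mem_outerDisk] at hq
      exact (chordalDist_infty_coe w).trans_le ((two_div_sqrt_le hM hq).trans h24)
  | coe z =>
    rw [coe_mem_outerDisk] at hp
    induction q using OnePoint.rec with
    | infty => exact (chordalDist_coe_infty z).trans_le ((two_div_sqrt_le hM hp).trans h24)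
    | coe w =>
      rw [coe_mem_outerDisk] at hq
      have hz := sqrt_one_add_pos z
      have hw := sqrt_one_add_pos w
      calc chordalDist z w
          ≤ 2 * (√(1 + ‖z‖ ^ 2) + √(1 + ‖w‖ ^ 2)) / (√(1 + ‖z‖ ^ 2) * √(1 + ‖w‖ ^ 2)) := by
            rw [chordalDist_coe_coe]
            gcongr
            exact (norm_sub_le z w).trans
              (add_le_add (norm_le_sqrt_one_add z) (norm_le_sqrt_one_add w))
        _ = 2 / √(1 + ‖w‖ ^ 2) + 2 / √(1 + ‖z‖ ^ 2) := by field_simp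
        _ ≤ 2 / M + 2 / M := add_le_add (two_div_sqrt_le hM hq) (two_div_sqrt_le hM hp)
        _ = 4 / M := by ring

lemma eventually_chordalDist_lt (p : OnePoint ℂ) {ε : ℝ} (hε : 0 < ε) :
    ∀ᶠ q in 𝓝 p, chordalDist p q < ε := by
  induction p using OnePoint.rec with
  | infty =>
    filter_upwards [(isOpen_outerDisk (8 / ε)).mem_nhds (infty_mem_outerDisk _)] with q hq
    refine (chordalDist_le_of_mem_outerDisk (by positivity) (infty_mem_outerDisk _) hq).trans_lt ?_
    rw [div_div_eq_mul_div, div_lt_iff₀ (by norm_num)]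
    linarith
  | coe z =>
    rw [OnePoint.nhds_coe_eq, eventually_map]
    have h : Continuous fun w : ℂ => 2 * ‖z - w‖ / (√(1 + ‖z‖ ^ 2) * √(1 + ‖w‖ ^ 2)) :=
      Continuous.div (by fun_prop) (by fun_prop)
        fun w => (mul_pos (sqrt_one_add_pos z) (sqrt_one_add_pos w)).ne'
    exact h.continuousAt.eventually_lt continuousAt_const (by simpa using hε)

/-- A uniform gap between a bounded disk and a neighbourhood of ∞, used to contradict equicontinuity
when one orbit escapes and another does not. -/
lemma le_chordalDist {R : ℝ} (hR : 1 ≤ R) {z : ℂ} (hz : ‖z‖ ≤ R) {q : OnePoint ℂ}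
    (hq : q ∈ outerDisk (2 * R)) : 1 / (2 * √(1 + R ^ 2)) ≤ chordalDist z q := by
  have hzR : √(1 + ‖z‖ ^ 2) ≤ √(1 + R ^ 2) := Real.sqrt_le_sqrt (by gcongr)
  have hz0 := sqrt_one_add_pos z
  induction q using OnePoint.rec with
  | infty =>
    rw [chordalDist_coe_infty]
    exact div_le_div₀ (by norm_num) (by norm_num) hz0 (by linarith)
  | coe w =>
    rw [coe_mem_outerDisk] at hq
    have hw0 := sqrt_one_add_pos w
    have hw : √(1 + ‖w‖ ^ 2) ≤ 2 * ‖w‖ := Real.sqrt_le_iff.2 ⟨by positivity, by nlinarith⟩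
    have h1 : ‖w‖ ≤ 2 * ‖z - w‖ := by
      have := norm_sub_norm_le w z
      rw [norm_sub_rev] at this
      linarith
    rw [chordalDist_coe_coe, div_le_div_iff₀ (by positivity) (by positivity)]
    calc 1 * (√(1 + ‖z‖ ^ 2) * √(1 + ‖w‖ ^ 2)) ≤ √(1 + R ^ 2) * (2 * ‖w‖) := by
          rw [one_mul]; gcongr
      _ ≤ √(1 + R ^ 2) * (2 * (2 * ‖z - w‖)) := by gcongr
      _ = _ := by ring

end Chordal

/-! ### The basin of infinity and the Fatou set -/

section Logistic

variable {a : ℝ}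

lemma logisticMap_coe (a : ℝ) (x : ℂ) :
    logisticMap a (x : OnePoint ℂ) = ((a * x * (1 - x) : ℂ) : OnePoint ℂ) := rfl

lemma logisticMap_infty (a : ℝ) : logisticMap a OnePoint.infty = OnePoint.infty := rfl

/-- Beyond this radius the logistic map at least doubles the modulus. -/
noncomputable def escapeRadius (a : ℝ) : ℝ := 1 + 2 / a

lemma one_le_escapeRadius (ha : 0 < a) : 1 ≤ escapeRadius a := by
  have : 0 < 2 / a := by positivity
  rw [escapeRadius]
  linarith

lemma two_mul_norm_le (ha : 0 < a) {x : ℂ} (hx : escapeRadius a ≤ ‖x‖) :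
    2 * ‖x‖ ≤ ‖(a : ℂ) * x * (1 - x)‖ := by
  rw [norm_mul, norm_mul, Complex.norm_real, Real.norm_of_nonneg ha.le]
  have h1 : ‖x‖ - 1 ≤ ‖1 - x‖ := by
    have := norm_sub_norm_le x 1
    rwa [norm_one, norm_sub_rev] at this
  have h2 : 2 ≤ a * (‖x‖ - 1) := by
    calc 2 = a * (2 / a) := by field_simp
      _ ≤ a * (‖x‖ - 1) := by
        gcongr
        rw [escapeRadius] at hx
        linarith
  nlinarith [norm_nonneg x, mul_le_mul_of_nonneg_left h1 ha.le]

lemma logisticMap_mem_outerDisk (ha : 0 < a) {M : ℝ} (hM : escapeRadius a ≤ M)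
    {p : OnePoint ℂ} (hp : p ∈ outerDisk M) : logisticMap a p ∈ outerDisk (2 * M) := by
  induction p using OnePoint.rec with
  | infty => exact infty_mem_outerDisk _
  | coe x =>
    rw [coe_mem_outerDisk] at hp
    rw [logisticMap_coe, coe_mem_outerDisk]
    linarith [two_mul_norm_le ha (hM.trans hp.le)]

lemma iterate_logisticMap_mem_outerDisk (ha : 0 < a) {p : OnePoint ℂ}
    (hp : p ∈ outerDisk (escapeRadius a)) (n : ℕ) :
    (logisticMap a)^[n] p ∈ outerDisk (2 ^ n * escapeRadius a) := by
  have h0 : 0 < escapeRadius a := by linarith [one_le_escapeRadius ha]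
  induction n with
  | zero => simpa using hp
  | succ n ih =>
    rw [Function.iterate_succ_apply', pow_succ', mul_assoc]
    exact logisticMap_mem_outerDisk ha
      (le_mul_of_one_le_left h0.le (one_le_pow₀ one_le_two)) ih

lemma continuous_logisticMap (ha : 0 < a) : Continuous (logisticMap a) := by
  refine OnePoint.continuous_map (by fun_prop) ?_
  rw [coclosedCompact_eq_cocompact, ← Metric.cobounded_eq_cocompact,
    ← tendsto_norm_atTop_iff_cobounded]
  have h : ∀ᶠ x : ℂ in Bornology.cobounded ℂ, escapeRadius a ≤ ‖x‖ :=
    tendsto_norm_cobounded_atTop.eventually_ge_atTop _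
  refine tendsto_atTop_mono' _ (h.mono fun x hx => ?_) tendsto_norm_cobounded_atTop
  linarith [two_mul_norm_le ha hx, norm_nonneg x]

/-- The basin of attraction of infinity of the logistic map. -/
def inftyBasin (a : ℝ) : Set (OnePoint ℂ) :=
  {p | ∃ n : ℕ, (logisticMap a)^[n] p ∈ outerDisk (escapeRadius a)}

lemma isOpen_inftyBasin (ha : 0 < a) : IsOpen (inftyBasin a) := by
  have : inftyBasin a = ⋃ n : ℕ, (logisticMap a)^[n] ⁻¹' outerDisk (escapeRadius a) := by
    ext p; simp [inftyBasin]
  rw [this]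
  exact isOpen_iUnion fun n => (isOpen_outerDisk _).preimage ((continuous_logisticMap ha).iterate n)

lemma infty_mem_inftyBasin (a : ℝ) : OnePoint.infty ∈ inftyBasin a :=
  ⟨0, infty_mem_outerDisk _⟩

/-- Continuity handles the finitely many early iterates. Later ones lie outside the disk of radius
2^m for both orbits, a set of chordal diameter at most 4 / 2^m < ε. -/
lemma iteratesEquicontinuousAt_of_mem_inftyBasin (ha : 0 < a) {p : OnePoint ℂ}
    (hp : p ∈ inftyBasin a) : IteratesEquicontinuousAt (logisticMap a) p := by
  intro ε hε
  obtain ⟨N, hN⟩ := hp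
  have hR := one_le_escapeRadius ha
  obtain ⟨m, hm⟩ : ∃ m : ℕ, 4 / ε < 2 ^ m := pow_unbounded_of_one_lt _ one_lt_two
  have h1 : ∀ᶠ w in 𝓝 p, (logisticMap a)^[N] w ∈ outerDisk (escapeRadius a) :=
    ((continuous_logisticMap ha).iterate N).continuousAt.eventually
      ((isOpen_outerDisk _).mem_nhds hN)
  have h2 : ∀ᶠ w in 𝓝 p, ∀ n ∈ Finset.range (N + m),
      chordalDist ((logisticMap a)^[n] p) ((logisticMap a)^[n] w) < ε := by
    rw [Finset.eventually_all]
    intro n _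
    exact ((continuous_logisticMap ha).iterate n).continuousAt.eventually
      (eventually_chordalDist_lt _ hε)
  filter_upwards [h1, h2] with w hw1 hw2 n
  by_cases hn : n < N + m
  · exact hw2 n (Finset.mem_range.2 hn)
  obtain ⟨k, rfl⟩ := Nat.exists_eq_add_of_le (not_lt.1 hn)
  have hmem : ∀ {q : OnePoint ℂ}, (logisticMap a)^[N] q ∈ outerDisk (escapeRadius a) →
      (logisticMap a)^[N + m + k] q ∈ outerDisk (2 ^ m) := by
    intro q hq
    have h := iterate_logisticMap_mem_outerDisk ha hq (m + k)
    rw [← Function.iterate_add_apply, show m + k + N = N + m + k by ring] at h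
    refine outerDisk_anti ?_ h
    rw [pow_add, mul_assoc]
    exact le_mul_of_one_le_right (by positivity)
      (one_le_mul_of_one_le_of_one_le (one_le_pow₀ one_le_two) hR)
  refine (chordalDist_le_of_mem_outerDisk (by positivity) (hmem hN) (hmem hw1)).trans_lt ?_
  rw [div_lt_iff₀ (by positivity)]
  rw [div_lt_iff₀ hε] at hm
  linarith

lemma inftyBasin_subset_fatouSet (ha : 0 < a) : inftyBasin a ⊆ fatouSet (logisticMap a) :=
  subset_sUnion_of_mem ⟨isOpen_inftyBasin ha,
    fun _ hp => iteratesEquicontinuousAt_of_mem_inftyBasin ha hp⟩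

/-- A non-escaping orbit never leaves the closed disk of radius `escapeRadius a`, whereas an
escaping one passes beyond twice that radius; at that time the two are a fixed chordal distance
apart. -/
lemma eventually_notMem_inftyBasin (ha : 0 < a) {p : OnePoint ℂ} (hp : p ∉ inftyBasin a)
    (he : IteratesEquicontinuousAt (logisticMap a) p) : ∀ᶠ q in 𝓝 p, q ∉ inftyBasin a := by
  have hR := one_le_escapeRadius ha
  filter_upwards [he (1 / (2 * √(1 + escapeRadius a ^ 2))) (by positivity)] with q hq hqB
  obtain ⟨n, hn⟩ := hqB
  have h1 : (logisticMap a)^[n + 1] q ∈ outerDisk (2 * escapeRadius a) := by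
    rw [Function.iterate_succ_apply']
    exact logisticMap_mem_outerDisk ha le_rfl hn
  have h2 : (logisticMap a)^[n + 1] p ∉ outerDisk (escapeRadius a) := fun h => hp ⟨_, h⟩
  have h3 := hq (n + 1)
  rw [outerDisk, notMem_compl_iff] at h2
  obtain ⟨z, hz, hzp⟩ := h2
  rw [← hzp] at h3
  exact absurd (le_chordalDist hR (by simpa using hz) h1) (not_le.2 h3)

/-- Fatou points outside the basin are interior to its complement, so the basin is open and closed
in the Fatou set; being connected, it is the component of ∞. -/
lemma sphereExterior_juliaSet_eq (ha : 0 < a) (hc : IsPreconnected (inftyBasin a)) :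
    sphereExterior (juliaSet (logisticMap a)) = inftyBasin a := by
  rw [sphereExterior, juliaSet, compl_compl]
  apply Subset.antisymm
  · have hsub := connectedComponentIn_subset (fatouSet (logisticMap a)) OnePoint.infty
    refine isPreconnected_connectedComponentIn.subset_left_of_subset_union
      (isOpen_inftyBasin ha) (isOpen_interior (s := (inftyBasin a)ᶜ)) ?_ ?_ ?_
    · exact (disjoint_compl_right).mono_right interior_subset
    · intro p hp
      by_cases hpB : p ∈ inftyBasin a
      · exact Or.inl hpB
      · obtain ⟨U, ⟨_, hU⟩, hpU⟩ := hsub hp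
        exact Or.inr (mem_interior_iff_mem_nhds.2 (eventually_notMem_inftyBasin ha hpB (hU p hpU)))
    · exact ⟨OnePoint.infty, mem_connectedComponentIn
        (inftyBasin_subset_fatouSet ha (infty_mem_inftyBasin a)), infty_mem_inftyBasin a⟩
  · exact hc.subset_connectedComponentIn (infty_mem_inftyBasin a) (inftyBasin_subset_fatouSet ha)

end Logistic

/-! ### The disk parametrizes the basin of infinity -/

section Basin

variable {b : ℝ}

/-- The parametrization `z ↦ -1 / G z` of the basin of infinity by the unit disk. -/
noncomputable def basinParam (b : ℝ) (z : ℂ) : OnePoint ℂ :=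
  sphereInv ((-conjMap b z : ℂ) : OnePoint ℂ)

lemma basinParam_zero (hb : 3 / 4 < b) (hb1 : b < 1) : basinParam b 0 = OnePoint.infty := by
  rw [basinParam, (conjMap_eq_zero_iff hb hb1 (by simp)).2 rfl, neg_zero, sphereInv_coe_zero]

lemma basinParam_of_ne_zero (hb : 3 / 4 < b) (hb1 : b < 1) {z : ℂ} (hz : ‖z‖ ≤ 1) (h0 : z ≠ 0) :
    basinParam b z = ((-conjMap b z)⁻¹ : ℂ) :=
  sphereInv_coe (neg_ne_zero.2 fun h => h0 ((conjMap_eq_zero_iff hb hb1 hz).1 h))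

lemma continuousOn_basinParam (hb : 3 / 4 < b) (hb1 : b < 1) :
    ContinuousOn (basinParam b) (ball 0 1) :=
  continuous_sphereInv_coe.comp_continuousOn (differentiableOn_conjMap hb hb1).continuousOn.neg

lemma logisticMap_basinParam (hb : 3 / 4 < b) (hb1 : b < 1) {z : ℂ} (hz : ‖z‖ ≤ 1) :
    logisticMap (2 * (1 - b)) (basinParam b z) = basinParam b (z ^ 2) := by
  by_cases h0 : z = 0
  · subst h0
    rw [zero_pow two_ne_zero, basinParam_zero hb hb1, logisticMap_infty]
  · have hz2 := norm_sq_le_one hz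
    have h1 : conjMap b z ≠ 0 := fun h => h0 ((conjMap_eq_zero_iff hb hb1 hz).1 h)
    have h2 : conjMap b (z ^ 2) ≠ 0 := fun h =>
      pow_ne_zero 2 h0 ((conjMap_eq_zero_iff hb hb1 hz2).1 h)
    rw [basinParam_of_ne_zero hb hb1 hz h0, basinParam_of_ne_zero hb hb1 hz2 (pow_ne_zero 2 h0),
      logisticMap_coe]
    congr 1
    have h3 := conjMap_sq hb hb1 hz
    field_simp
    linear_combination h3

lemma iterate_logisticMap_basinParam (hb : 3 / 4 < b) (hb1 : b < 1) {z : ℂ} (hz : ‖z‖ ≤ 1)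
    (n : ℕ) : (logisticMap (2 * (1 - b)))^[n] (basinParam b z) = basinParam b (z ^ 2 ^ n) := by
  induction n with
  | zero => simp
  | succ n ih =>
    rw [Function.iterate_succ_apply', ih, logisticMap_basinParam hb hb1, ← pow_mul, pow_succ]
    rw [norm_pow]
    exact pow_le_one₀ (norm_nonneg _) hz

lemma basinParam_mem_inftyBasin (hb : 3 / 4 < b) (hb1 : b < 1) {z : ℂ} (hz : ‖z‖ < 1) :
    basinParam b z ∈ inftyBasin (2 * (1 - b)) := by
  have h1 : Tendsto (fun n : ℕ => z ^ 2 ^ n) atTop (𝓝 0) :=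
    (tendsto_pow_atTop_nhds_zero_of_norm_lt_one hz).comp
      (tendsto_pow_atTop_atTop_of_one_lt one_lt_two)
  have h2 : ContinuousAt (basinParam b) 0 :=
    (continuousOn_basinParam hb hb1).continuousAt (ball_mem_nhds 0 one_pos)
  have h3 := (h2.tendsto.comp h1).eventually
    ((isOpen_outerDisk (escapeRadius (2 * (1 - b)))).mem_nhds (by
      rw [basinParam_zero hb hb1]; exact infty_mem_outerDisk _))
  obtain ⟨n, hn⟩ := h3.exists
  refine ⟨n, ?_⟩
  rw [iterate_logisticMap_basinParam hb hb1 hz.le]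
  exact hn

/-- The involution x ↦ 1 - x swaps the two logistic preimages of a point. As x = 1/2 - w/a and w is
odd, it corresponds to z ↦ -z. -/
lemma basinParam_neg (hb : 3 / 4 < b) (hb1 : b < 1) {z : ℂ} (hz : ‖z‖ ≤ 1) (h0 : z ≠ 0) :
    basinParam b (-z) = ((1 - (-conjMap b z)⁻¹ : ℂ) : OnePoint ℂ) := by
  rw [basinParam_of_ne_zero hb hb1 (by simpa using hz) (neg_ne_zero.2 h0)]
  congr 1
  have h1 := conjMap_denom_ne_zero hb hb1 hz
  have h2 := conjMap_denom_ne_zero' hb hb1 hz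
  have h3 : bottcherInv b z ≠ 0 := fun h => h0 (bottcherInv_eq_zero_iff.1 h)
  have h4 : (1 - b : ℂ) ≠ 0 := by
    have : (1 - b : ℝ) ≠ 0 := by linarith
    exact_mod_cast this
  simp only [conjMap, bottcherInv_neg hb hb1 hz]
  push_cast at *
  rw [mul_neg, mul_neg, sub_neg_eq_add]
  field_simp
  ring

/-- If the image point has parameter `z ^ 2`, then `z` and `-z` parametrize both roots of the
quadratic equation for the preimages. -/
lemma mem_image_basinParam_of_logisticMap (hb : 3 / 4 < b) (hb1 : b < 1) {p : OnePoint ℂ}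
    (hp : logisticMap (2 * (1 - b)) p ∈ basinParam b '' ball 0 1) :
    p ∈ basinParam b '' ball 0 1 := by
  induction p using OnePoint.rec with
  | infty => exact ⟨0, by simp, basinParam_zero hb hb1⟩
  | coe x =>
    obtain ⟨y, hy, hyx⟩ := hp
    obtain ⟨z, rfl⟩ : ∃ z : ℂ, z ^ 2 = y := IsAlgClosed.exists_pow_nat_eq y two_pos
    have hz : ‖z‖ < 1 := by
      rw [mem_ball_zero_iff, norm_pow] at hy
      exact (pow_lt_one_iff_of_nonneg (norm_nonneg _) two_ne_zero).1 hy
    have h0 : z ≠ 0 := by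
      rintro rfl
      rw [zero_pow two_ne_zero, basinParam_zero hb hb1, logisticMap_coe] at hyx
      exact OnePoint.infty_ne_coe _ hyx
    rw [← logisticMap_basinParam hb hb1 hz.le, basinParam_of_ne_zero hb hb1 hz.le h0,
      logisticMap_coe, logisticMap_coe, OnePoint.coe_eq_coe] at hyx
    have h4 : ((2 * (1 - b) : ℝ) : ℂ) ≠ 0 := by
      have : (2 * (1 - b) : ℝ) ≠ 0 := by linarith
      exact_mod_cast this
    have h5 : (x - (-conjMap b z)⁻¹) * (x - (1 - (-conjMap b z)⁻¹)) = 0 := by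
      apply mul_left_cancel₀ h4
      linear_combination hyx
    rcases mul_eq_zero.1 h5 with h | h
    · exact ⟨z, by simpa using hz, by
        rw [basinParam_of_ne_zero hb hb1 hz.le h0, sub_eq_zero.1 h]⟩
    · exact ⟨-z, by simpa using hz, by
        rw [basinParam_neg hb hb1 hz.le h0, sub_eq_zero.1 h]⟩

lemma exists_outerDisk_subset_image (hb : 3 / 4 < b) (hb1 : b < 1) :
    ∃ M : ℝ, outerDisk M ⊆ basinParam b '' ball 0 1 := by
  have h : conjMap b '' ball 0 1 ∈ 𝓝 (0 : ℂ) := by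
    rw [← map_nhds_conjMap_zero hb hb1]
    exact image_mem_map (ball_mem_nhds 0 one_pos)
  obtain ⟨ε, hε, hsub⟩ := Metric.mem_nhds_iff.1 h
  refine ⟨ε⁻¹, fun p hp => ?_⟩
  induction p using OnePoint.rec with
  | infty => exact ⟨0, by simp, basinParam_zero hb hb1⟩
  | coe x =>
    rw [coe_mem_outerDisk] at hp
    have hx0 : 0 < ‖x‖ := (inv_pos.2 hε).trans hp
    have hx : -x⁻¹ ∈ ball (0 : ℂ) ε := by
      rw [mem_ball_zero_iff, norm_neg, norm_inv]
      exact inv_lt_of_inv_lt₀ hε hp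
    obtain ⟨z, hz, hzx⟩ := hsub hx
    refine ⟨z, hz, ?_⟩
    rw [basinParam, hzx, neg_neg, sphereInv_coe (inv_ne_zero (norm_pos_iff.1 hx0)), inv_inv]

/-- An escaping orbit enters the neighbourhood of ∞ already covered by the image; closedness under
preimages then leads back to its starting point. -/
lemma image_basinParam (hb : 3 / 4 < b) (hb1 : b < 1) :
    basinParam b '' ball 0 1 = inftyBasin (2 * (1 - b)) := by
  have ha : 0 < 2 * (1 - b) := by linarith
  apply Subset.antisymm
  · rintro _ ⟨z, hz, rfl⟩
    exact basinParam_mem_inftyBasin hb hb1 (by simpa using hz)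
  · rintro p ⟨N, hN⟩
    obtain ⟨M, hM⟩ := exists_outerDisk_subset_image hb hb1
    obtain ⟨m, hm⟩ : ∃ m : ℕ, M < 2 ^ m := pow_unbounded_of_one_lt _ one_lt_two
    have h1 : (logisticMap (2 * (1 - b)))^[m + N] p ∈ basinParam b '' ball 0 1 := by
      rw [Function.iterate_add_apply]
      refine hM (outerDisk_anti ?_ (iterate_logisticMap_mem_outerDisk ha hN m))
      exact hm.le.trans (le_mul_of_one_le_right (by positivity) (one_le_escapeRadius ha))
    generalize m + N = n at h1
    induction n with
    | zero => exact h1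
    | succ n ih =>
      rw [Function.iterate_succ_apply'] at h1
      exact ih (mem_image_basinParam_of_logisticMap hb hb1 h1)

lemma image_neg_conjMap (hb : 3 / 4 < b) (hb1 : b < 1) :
    (fun z : ℂ => ((-conjMap b z : ℂ) : OnePoint ℂ)) '' ball 0 1 =
      sphereInv '' sphereExterior (juliaSet (logisticMap (2 * (1 - b)))) := by
  have hc : IsPreconnected (inftyBasin (2 * (1 - b))) := by
    rw [← image_basinParam hb hb1]
    exact (convex_ball (0 : ℂ) 1).isPreconnected.image _ (continuousOn_basinParam hb hb1)
  rw [sphereExterior_juliaSet_eq (by linarith) hc, ← image_basinParam hb hb1, image_image]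
  simp only [basinParam, sphereInv_involutive _]

end Basin

/-! ### Logarithmic coordinate: squaring becomes doubling -/

/-- The logarithm of the inverse Böttcher coordinate at `exp (-s)`. -/
noncomputable def logCoord (b : ℝ) (s : ℂ) : ℂ := s + bottcherLog b (Complex.exp (-s))

lemma norm_exp_neg_le_one {s : ℂ} (hs : 0 ≤ s.re) : ‖Complex.exp (-s)‖ ≤ 1 := by
  rw [Complex.norm_exp, Complex.neg_re]
  exact Real.exp_le_one_iff.2 (by linarith)

section LogCoord

variable {b : ℝ}

lemma logCoord_eq (hb : 3 / 4 < b) (hb1 : b < 1) {s : ℂ} (hs : 0 ≤ s.re) :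
    logCoord b s = logBranch b 1 (logCoord b (2 * s)) := by
  have h : Complex.exp (-s) ^ 2 = Complex.exp (-(2 * s)) := by
    rw [← Complex.exp_nat_mul]; congr 1; push_cast; ring
  rw [logCoord, bottcherLog_eq hb hb1 (norm_exp_neg_le_one hs), h, add_logBranch_exp, logCoord]

lemma le_re_logCoord (hb : 3 / 4 < b) (hb1 : b < 1) {s : ℂ} (hs : 0 ≤ s.re) :
    Real.log b + s.re ≤ (logCoord b s).re := by
  have := log_le_re_bottcherLog hb hb1 (norm_exp_neg_le_one hs)
  rw [logCoord, Complex.add_re]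
  linarith

lemma log_le_re_logCoord (hb : 3 / 4 < b) (hb1 : b < 1) {s : ℂ} (hs : 0 ≤ s.re) :
    Real.log b ≤ (logCoord b s).re := by
  linarith [le_re_logCoord hb hb1 hs]

lemma norm_logCoord_sub_self_le (hb : 3 / 4 < b) (hb1 : b < 1) {s : ℂ} (hs : 0 ≤ s.re) :
    ‖logCoord b s - s‖ ≤ 9 / 4 := by
  rw [logCoord, add_sub_cancel_left]
  exact norm_bottcherLog_le hb hb1 (norm_exp_neg_le_one hs)

lemma exp_neg_logCoord (b : ℝ) (s : ℂ) :
    Complex.exp (-logCoord b s) = bottcherInv b (Complex.exp (-s)) := by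
  rw [logCoord, neg_add, Complex.exp_add, bottcherInv]

lemma norm_logCoord_sub_le (hb : 3 / 4 < b) (hb1 : b < 1) (n : ℕ) :
    ∀ {s t : ℂ}, 0 ≤ s.re → 0 ≤ t.re → ‖logCoord b s - logCoord b t‖ ≤
      ((2 * b)⁻¹) ^ n * ‖logCoord b (2 ^ n * s) - logCoord b (2 ^ n * t)‖ := by
  induction n with
  | zero => intro s t _ _; simp
  | succ n ih =>
    intro s t hs ht
    have hs2 : 0 ≤ (2 * s).re := by simpa using hs
    have ht2 : 0 ≤ (2 * t).re := by simpa using ht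
    rw [logCoord_eq hb hb1 hs, logCoord_eq hb hb1 ht]
    refine (norm_logBranch_sub_le hb.le le_rfl hb1 (by simp) (log_le_re_logCoord hb hb1 hs2)
      (log_le_re_logCoord hb hb1 ht2)).trans ?_
    rw [pow_succ' (2 * b)⁻¹, mul_assoc, pow_succ (2 : ℂ), mul_assoc, mul_assoc (2 ^ n : ℂ)]
    exact mul_le_mul_of_nonneg_left (ih hs2 ht2) (by positivity)

lemma logb_pos (hb : 3 / 4 < b) : 0 < Real.logb 2 (2 * b) :=
  Real.logb_pos one_lt_two (by linarith)

lemma logb_lt_one (hb : 3 / 4 < b) (hb1 : b < 1) : Real.logb 2 (2 * b) < 1 := by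
  rw [Real.logb_lt_iff_lt_rpow one_lt_two (by linarith), Real.rpow_one]
  linarith

lemma two_rpow_logb (hb : 3 / 4 < b) : (2 : ℝ) ^ Real.logb 2 (2 * b) = 2 * b :=
  Real.rpow_logb two_pos (by norm_num) (by linarith)

/-- Double until the distance is comparable to 1. There `logCoord` is within 9/4 of the identity, so
the two values differ by at most 9/4 + 9/4 + 1 = 11/2. The contraction over `n` doublings is (2b)⁻ⁿ,
and (2b)⁻⁽ⁿ⁺¹⁾ is at most ‖s - t‖^β; the extra factor 2b turns 11/2 into 11b ≤ 11. -/
lemma norm_logCoord_sub_le_rpow (hb : 3 / 4 < b) (hb1 : b < 1) {s t : ℂ} (hs : 0 ≤ s.re)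
    (ht : 0 ≤ t.re) (hst : ‖s - t‖ ≤ 1) :
    ‖logCoord b s - logCoord b t‖ ≤ 11 * ‖s - t‖ ^ Real.logb 2 (2 * b) := by
  by_cases h0 : s = t
  · subst h0
    simp [Real.zero_rpow (logb_pos hb).ne']
  set d := ‖s - t‖ with hd
  have hd0 : 0 < d := norm_pos_iff.2 (sub_ne_zero.2 h0)
  obtain ⟨n, hn1, hn2⟩ := exists_nat_pow_near (one_le_inv₀ hd0 |>.2 hst) (one_lt_two (α := ℝ))
  have h1 : (2 : ℝ) ^ n * d ≤ 1 := by
    rwa [← le_div_iff₀ hd0, one_div]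
  have h2 : ((2 * b)⁻¹) ^ (n + 1) ≤ d ^ Real.logb 2 (2 * b) := by
    have := Real.rpow_le_rpow (by positivity) hn2.le (logb_pos hb).le
    rw [← Real.rpow_natCast 2, ← Real.rpow_mul two_pos.le, mul_comm ((n + 1 : ℕ) : ℝ),
      Real.rpow_mul two_pos.le,
      two_rpow_logb hb, Real.rpow_natCast, Real.inv_rpow hd0.le] at this
    rw [inv_pow]
    exact inv_le_of_inv_le₀ (by positivity) this
  have h3 : ‖logCoord b (2 ^ n * s) - logCoord b (2 ^ n * t)‖ ≤ 11 / 2 := by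
    have hre : ∀ {u : ℂ}, 0 ≤ u.re → 0 ≤ (2 ^ n * u).re := by
      intro u hu
      have : ((2 : ℂ) ^ n) = ((2 ^ n : ℝ) : ℂ) := by push_cast; rfl
      rw [this, Complex.re_ofReal_mul]
      positivity
    have e1 := norm_logCoord_sub_self_le hb hb1 (hre hs)
    have e2 := norm_logCoord_sub_self_le hb hb1 (hre ht)
    have e3 : ‖(2 : ℂ) ^ n * s - 2 ^ n * t‖ ≤ 1 := by
      rw [← mul_sub, norm_mul, norm_pow, Complex.norm_ofNat]
      exact h1
    calc _ = ‖(logCoord b (2 ^ n * s) - 2 ^ n * s) - (logCoord b (2 ^ n * t) - 2 ^ n * t) +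
          ((2 : ℂ) ^ n * s - 2 ^ n * t)‖ := by congr 1; ring
      _ ≤ 9 / 4 + 9 / 4 + 1 :=
        (norm_add_le _ _).trans (add_le_add ((norm_sub_le _ _).trans (add_le_add e1 e2)) e3)
      _ = 11 / 2 := by norm_num
  calc _ ≤ ((2 * b)⁻¹) ^ n * (11 / 2) :=
        (norm_logCoord_sub_le hb hb1 n hs ht).trans (by gcongr)
    _ = (11 * b) * ((2 * b)⁻¹) ^ (n + 1) := by
        have : b ≠ 0 := by linarith
        rw [pow_succ]; field_simp
    _ ≤ 11 * d ^ Real.logb 2 (2 * b) := by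
        gcongr
        linarith

end LogCoord

/-! ### Hölder continuity on the closed disk -/

section Holder

variable {b : ℝ}

lemma norm_exp_neg_sub_exp_neg_le {v w : ℂ} (hv : Real.log (3 / 4) ≤ v.re)
    (hw : Real.log (3 / 4) ≤ w.re) :
    ‖Complex.exp (-v) - Complex.exp (-w)‖ ≤ 4 / 3 * ‖v - w‖ := by
  refine Convex.norm_image_sub_le_of_norm_hasDerivWithin_le
    (s := {p : ℂ | Real.log (3 / 4) ≤ p.re}) (f := fun p => Complex.exp (-p))
    (f' := fun p => -Complex.exp (-p))
    (fun x _ => ?_) (fun x hx => ?_) (convex_halfSpace_re_ge _) hw hv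
  · exact ((hasDerivAt_neg x).cexp.congr_deriv (by ring)).hasDerivWithinAt
  · rw [norm_neg]
    exact (norm_exp_neg_le (by norm_num) hx).trans (by norm_num)

lemma log_three_fourths_le (hb : 3 / 4 < b) : Real.log (3 / 4) ≤ Real.log b :=
  Real.log_le_log (by norm_num) hb.le

/-- Distant points are handled by boundedness, points near the centre by a derivative bound `C`, and
points near the circle by logarithms. In the last case the constant is 44 = (4/3) · 11 · 3, from the
exponential, `norm_logCoord_sub_le_rpow` and the change of variable. -/
lemma exists_holder_bottcherInv (hb : 3 / 4 < b) (hb1 : b < 1) :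
    ∃ K : ℝ, 0 ≤ K ∧ ∀ z ∈ closedBall (0 : ℂ) 1, ∀ w ∈ closedBall (0 : ℂ) 1,
      ‖bottcherInv b z - bottcherInv b w‖ ≤ K * ‖z - w‖ ^ Real.logb 2 (2 * b) := by
  have hβ0 := logb_pos hb
  have hβ1 := logb_lt_one hb hb1
  have hsub : closedBall (0 : ℂ) (3 / 4) ⊆ ball 0 1 := closedBall_subset_ball (by norm_num)
  obtain ⟨C, hC⟩ := (isCompact_closedBall (0 : ℂ) (3 / 4)).exists_bound_of_continuousOn
    (((differentiableOn_bottcherInv hb hb1).deriv isOpen_ball).continuousOn.mono hsub)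
  have hC0 : 0 ≤ C := (norm_nonneg _).trans (hC 0 (mem_closedBall_self (by norm_num)))
  have hpow : ∀ {d : ℝ}, 0 ≤ d → d ≤ 1 → d ≤ d ^ Real.logb 2 (2 * b) := fun h0 h1 =>
    Real.self_le_rpow_of_le_one h0 h1 hβ1.le
  refine ⟨C + 44 + 11, by positivity, fun z hz w hw => ?_⟩
  rw [mem_closedBall_zero_iff] at hz hw
  set P := ‖z - w‖ ^ Real.logb 2 (2 * b) with hP
  have hP0 : 0 ≤ P := by positivity
  by_cases hfar : 1 / 4 ≤ ‖z - w‖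
  · have h1 : (1 / 4 : ℝ) ≤ P :=
      (hpow (by norm_num) (by norm_num)).trans (Real.rpow_le_rpow (by norm_num) hfar hβ0.le)
    have h2 := norm_sub_le (bottcherInv b z) (bottcherInv b w)
    have h3 := norm_bottcherInv_le_four_thirds hb hb1 hz
    have h4 := norm_bottcherInv_le_four_thirds hb hb1 hw
    nlinarith [mul_nonneg hC0 hP0]
  rw [not_le] at hfar
  by_cases hin : ‖z‖ < 1 / 2
  · have hz' : z ∈ closedBall (0 : ℂ) (3 / 4) := by simpa using by linarith
    have hw' : w ∈ closedBall (0 : ℂ) (3 / 4) := by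
      rw [mem_closedBall_zero_iff]
      have := norm_sub_norm_le w z
      rw [norm_sub_rev] at this
      linarith
    have h1 := Convex.norm_image_sub_le_of_norm_deriv_le (𝕜 := ℂ) (f := bottcherInv b)
      (fun x hx => (differentiableOn_bottcherInv hb hb1).differentiableAt
        (isOpen_ball.mem_nhds (hsub hx))) hC (convex_closedBall _ _) hw' hz'
    have h2 := mul_le_mul_of_nonneg_left (hpow (norm_nonneg (z - w)) (by linarith)) hC0
    linarith [mul_nonneg hC0 hP0]
  rw [not_lt] at hin
  have hz0 : z ≠ 0 := norm_pos_iff.1 (by linarith)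
  have hw0 : w ≠ 0 := by
    rintro rfl
    rw [sub_zero] at hfar
    linarith
  set s := -Complex.log z with hs
  -- Taking `-log w` instead could put `t` about 2π away from `s` across the branch cut.
  set t := s - Complex.log (w / z) with ht
  have hzs : Complex.exp (-s) = z := by rw [hs, neg_neg, Complex.exp_log hz0]
  have hwt : Complex.exp (-t) = w := by
    rw [ht, neg_sub, sub_eq_add_neg, Complex.exp_add, hzs, Complex.exp_log (div_ne_zero hw0 hz0),
      div_mul_cancel₀ _ hz0]
  have hre : ∀ {u v : ℂ}, ‖v‖ ≤ 1 → Complex.exp (-u) = v → 0 ≤ u.re := by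
    intro u v hv huv
    rw [← huv, Complex.norm_exp, Real.exp_le_one_iff, Complex.neg_re] at hv
    linarith
  have hs0 := hre hz hzs
  have ht0 := hre hw hwt
  have hq : ‖w / z - 1‖ ≤ 2 * ‖z - w‖ := by
    rw [div_sub_one hz0, norm_div, norm_sub_rev, div_le_iff₀ (by linarith)]
    nlinarith [norm_nonneg (z - w)]
  have hst : ‖s - t‖ ≤ 3 * ‖z - w‖ := by
    have := Complex.norm_log_one_add_half_le_self (z := w / z - 1) (by linarith)
    rw [add_sub_cancel] at this
    rw [ht, sub_sub_cancel]
    linarith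
  have h1 := norm_logCoord_sub_le_rpow hb hb1 hs0 ht0 (by linarith)
  have h2 : ‖s - t‖ ^ Real.logb 2 (2 * b) ≤ 3 * P := by
    refine (Real.rpow_le_rpow (norm_nonneg _) hst hβ0.le).trans ?_
    rw [Real.mul_rpow (by norm_num) (norm_nonneg _)]
    gcongr
    exact Real.rpow_le_self_of_one_le (by norm_num) hβ1.le
  have h3 := norm_exp_neg_sub_exp_neg_le
    ((log_three_fourths_le hb).trans (log_le_re_logCoord hb hb1 hs0))
    ((log_three_fourths_le hb).trans (log_le_re_logCoord hb hb1 ht0))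
  rw [exp_neg_logCoord, exp_neg_logCoord, hzs, hwt] at h3
  nlinarith [mul_nonneg hC0 hP0]

/-- The Möbius map that turns `bottcherInv` into `conjMap` is Lipschitz. -/
lemma norm_moebius_sub_le (hb : 3 / 4 < b) (hb1 : b < 1) {x y : ℂ} (hx : ‖x‖ ≤ 4 / 3)
    (hy : ‖y‖ ≤ 4 / 3) :
    ‖(2 * (1 - b) : ℝ) * x / (1 - (1 - b : ℝ) * x) -
      (2 * (1 - b) : ℝ) * y / (1 - (1 - b : ℝ) * y)‖ ≤ 9 / 8 * ‖x - y‖ := by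
  have h1 := two_thirds_le_norm_one_sub hb hb1 hx
  have h2 := two_thirds_le_norm_one_sub hb hb1 hy
  have h3 : 1 - (1 - b : ℝ) * x ≠ 0 := norm_pos_iff.1 (by linarith)
  have h4 : 1 - (1 - b : ℝ) * y ≠ 0 := norm_pos_iff.1 (by linarith)
  have h5 : (2 * (1 - b) : ℝ) * x / (1 - (1 - b : ℝ) * x) -
      (2 * (1 - b) : ℝ) * y / (1 - (1 - b : ℝ) * y) =
      (2 * (1 - b) : ℝ) * (x - y) / ((1 - (1 - b : ℝ) * x) * (1 - (1 - b : ℝ) * y)) := by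
    rw [div_sub_div _ _ h3 h4]
    ring
  rw [h5, norm_div, norm_mul, norm_mul, Complex.norm_real, Real.norm_of_nonneg (by linarith),
    div_le_iff₀ (by positivity)]
  have h6 : 4 / 9 ≤ ‖1 - (1 - b : ℝ) * x‖ * ‖1 - (1 - b : ℝ) * y‖ := by nlinarith
  nlinarith [norm_nonneg (x - y), mul_le_mul_of_nonneg_left h6 (norm_nonneg (x - y))]

lemma exists_holder_conjMap (hb : 3 / 4 < b) (hb1 : b < 1) :
    ∃ K : ℝ, ∀ z ∈ closedBall (0 : ℂ) 1, ∀ w ∈ closedBall (0 : ℂ) 1,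
      ‖conjMap b z - conjMap b w‖ ≤ K * ‖z - w‖ ^ Real.logb 2 (2 * b) := by
  obtain ⟨K, _, hK⟩ := exists_holder_bottcherInv hb hb1
  refine ⟨9 / 8 * K, fun z hz w hw => ?_⟩
  refine (norm_moebius_sub_le hb hb1
    (norm_bottcherInv_le_four_thirds hb hb1 (by simpa using hz))
    (norm_bottcherInv_le_four_thirds hb hb1 (by simpa using hw))).trans ?_
  linarith [hK z hz w hw]

end Holder

/-! ### The singularity barrier -/

section Barrier

variable {b : ℝ}

lemma inv_bottcherInv_sq (hb : 3 / 4 < b) (hb1 : b < 1) {z : ℂ} (hz : ‖z‖ ≤ 1) (h0 : z ≠ 0) :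
    (bottcherInv b (z ^ 2))⁻¹ = (bottcherInv b z)⁻¹ ^ 2 + (b * (1 - b) : ℝ) := by
  have h1 : bottcherInv b z ≠ 0 := fun h => h0 (bottcherInv_eq_zero_iff.1 h)
  have h2 : bottcherInv b (z ^ 2) ≠ 0 := fun h =>
    pow_ne_zero 2 h0 (bottcherInv_eq_zero_iff.1 h)
  have h3 := bottcherInv_sq hb hb1 hz
  field_simp
  linear_combination h3

/-- At z = 1 the functional equation says that w is a fixed point, so w is b or 1 - b; the bound |w|
≥ b excludes 1 - b. -/
lemma inv_bottcherInv_one (hb : 3 / 4 < b) (hb1 : b < 1) : (bottcherInv b 1)⁻¹ = b := by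
  have h1 := inv_bottcherInv_sq hb hb1 (z := 1) (by simp) one_ne_zero
  rw [one_pow] at h1
  set w := (bottcherInv b 1)⁻¹ with hw
  have h2 : (w - b) * (w - (1 - b : ℝ)) = 0 := by push_cast at *; linear_combination -h1
  rcases mul_eq_zero.1 h2 with h | h
  · exact sub_eq_zero.1 h
  · exfalso
    have h3 := norm_bottcherInv_le hb hb1 (z := 1) (by simp)
    rw [← inv_inv (bottcherInv b 1), ← hw, sub_eq_zero.1 h, norm_inv, Complex.norm_real,
      Real.norm_of_nonneg (by linarith), norm_one, one_div,
      inv_le_inv₀ (by linarith) (by linarith)] at h3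
    linarith

/-- Differentiating g(2s) = g(s)² + b(1 - b) at 0, where g(0) = b, gives 2κ = 2bκ, so κ = 0. But
|g(s)| ≥ b exp(s) makes g grow at least linearly. -/
lemma not_hasDerivWithinAt_inv_bottcherInv (hb : 3 / 4 < b) (hb1 : b < 1) (κ : ℂ) :
    ¬ HasDerivWithinAt (fun s : ℝ => (bottcherInv b (Complex.exp (-s)))⁻¹) κ (Ici 0) 0 := by
  intro h
  set g : ℝ → ℂ := fun s => (bottcherInv b (Complex.exp (-s)))⁻¹ with hg
  have hg0 : g 0 = b := by simp [hg, inv_bottcherInv_one hb hb1]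
  have hg2 : ∀ s ∈ Ici (0 : ℝ), g (2 * s) = g s ^ 2 + (b * (1 - b) : ℝ) := by
    intro s hs
    have := inv_bottcherInv_sq hb hb1 (z := Complex.exp (-s))
      (norm_exp_neg_le_one (by simpa using hs)) (Complex.exp_ne_zero _)
    rw [hg]
    simp only
    rw [← this, ← Complex.exp_nat_mul]
    congr 3
    push_cast
    ring
  have h1 : HasDerivWithinAt (fun s => g (2 * s)) ((2 : ℝ) • κ) (Ici 0) 0 := by
    have h2 : HasDerivWithinAt (fun s : ℝ => 2 * s) 2 (Ici 0) 0 := by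
      simpa using ((hasDerivAt_id (0 : ℝ)).const_mul 2).hasDerivWithinAt
    refine HasDerivWithinAt.scomp (t' := Ici 0) 0 (by simpa using h) h2 fun s hs => ?_
    simpa using hs
  have h2 : HasDerivWithinAt (fun s => g (2 * s)) (2 * b * κ) (Ici 0) 0 := by
    have := (h.pow 2).add_const ((b * (1 - b) : ℝ) : ℂ)
    refine (this.congr (fun s hs => hg2 s hs) (hg2 0 self_mem_Ici)).congr_deriv ?_
    simp [hg0]
  have h3 := (uniqueDiffWithinAt_Ici (0 : ℝ)).eq_deriv _ h1 h2
  have hκ : κ = 0 := by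
    have h4 : (2 * (1 - b) : ℂ) * κ = 0 := by
      rw [Complex.real_smul] at h3
      push_cast at h3
      linear_combination h3
    refine (mul_eq_zero.1 h4).resolve_left ?_
    have : (2 * (1 - b) : ℝ) ≠ 0 := by linarith
    exact_mod_cast this
  rw [hκ, hasDerivWithinAt_iff_isLittleO, Asymptotics.isLittleO_iff] at h
  have h5 := (h (show (0 : ℝ) < 1 / 2 by norm_num)).filter_mono
    (nhdsWithin_mono 0 Ioi_subset_Ici_self)
  obtain ⟨s, hs, hs0⟩ := (h5.and self_mem_nhdsWithin).exists
  replace hs0 : 0 < s := hs0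
  rw [smul_zero, sub_zero, sub_zero, hg0, Real.norm_of_nonneg hs0.le] at hs
  have h6 := norm_sub_norm_le (g s) b
  have h7 : b * Real.exp s ≤ ‖g s‖ := by
    have h8 := norm_bottcherInv_le hb hb1 (z := Complex.exp (-s))
      (norm_exp_neg_le_one (by simpa using hs0.le))
    rw [Complex.norm_exp, Complex.neg_re, Complex.ofReal_re, Real.exp_neg] at h8
    rw [hg, norm_inv]
    refine le_inv_of_le_inv₀ (norm_pos_iff.2 fun h => ?_) ?_
    · exact Complex.exp_ne_zero _ (bottcherInv_eq_zero_iff.1 h)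
    · rwa [mul_inv, mul_comm, ← div_eq_mul_inv]
  rw [Complex.norm_real, Real.norm_of_nonneg (by linarith)] at h6
  nlinarith [Real.add_one_le_exp s]

/-- Radial differentiability passes from `conjMap` to w by the Möbius relation, then forward along
w(z²) = w(z)² + b(1 - b). After `n` steps `ω` has become 1 and `s` has become 2ⁿs, which contradicts
the case of the point 1. -/
lemma not_hasDerivWithinAt_conjMap (hb : 3 / 4 < b) (hb1 : b < 1) {ω : ℂ} {n : ℕ}
    (hω : ω ^ 2 ^ n = 1) (κ : ℂ) :
    ¬ HasDerivWithinAt (fun s : ℝ => conjMap b (ω * Complex.exp (-s))) κ (Ici 0) 0 := by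
  intro h
  have hω1 : ‖ω‖ = 1 := by
    have : ‖ω‖ ^ 2 ^ n = 1 := by rw [← norm_pow, hω, norm_one]
    exact (pow_eq_one_iff_of_nonneg (norm_nonneg _) (by positivity)).1 this
  have hω0 : ω ≠ 0 := norm_pos_iff.1 (by rw [hω1]; exact one_pos)
  have hz1 : ∀ s ∈ Ici (0 : ℝ), ‖ω * Complex.exp (-s)‖ ≤ 1 := by
    intro s hs
    rw [norm_mul, hω1, one_mul]
    exact norm_exp_neg_le_one (by simpa using hs)
  have hz0 : ∀ s : ℝ, ω * Complex.exp (-s) ≠ 0 := fun s => mul_ne_zero hω0 (Complex.exp_ne_zero _)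
  have key : ∀ m : ℕ, ∃ κ' : ℂ, HasDerivWithinAt
      (fun s : ℝ => (bottcherInv b ((ω * Complex.exp (-s)) ^ 2 ^ m))⁻¹) κ' (Ici 0) 0 := by
    intro m
    induction m with
    | zero =>
      have hne : conjMap b (ω * Complex.exp (-(0 : ℝ))) ≠ 0 := fun h0 =>
        hz0 0 ((conjMap_eq_zero_iff hb hb1 (hz1 0 self_mem_Ici)).1 h0)
      have h1 := (((h.fun_inv hne).const_mul ((2 * (1 - b) : ℝ) : ℂ)).const_add
        ((1 - b : ℝ) : ℂ))
      have heq : ∀ s ∈ Ici (0 : ℝ), (bottcherInv b ((ω * Complex.exp (-s)) ^ 2 ^ 0))⁻¹ =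
          ((1 - b : ℝ) : ℂ) + ((2 * (1 - b) : ℝ) : ℂ) *
            (conjMap b (ω * Complex.exp (-s)))⁻¹ := by
        intro s hs
        have e1 := conjMap_denom_ne_zero hb hb1 (hz1 s hs)
        have e2 : bottcherInv b (ω * Complex.exp (-s)) ≠ 0 := fun h =>
          hz0 s (bottcherInv_eq_zero_iff.1 h)
        have e3 : ((2 * (1 - b) : ℝ) : ℂ) ≠ 0 := by
          have : (2 * (1 - b) : ℝ) ≠ 0 := by linarith
          exact_mod_cast this
        rw [pow_zero, pow_one, conjMap, inv_div]
        push_cast at *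
        have e4 := right_ne_zero_of_mul e3
        field_simp
        ring
      exact ⟨_, h1.congr heq (heq 0 self_mem_Ici)⟩
    | succ m ih =>
      obtain ⟨κ', hκ'⟩ := ih
      have heq : ∀ s ∈ Ici (0 : ℝ), (bottcherInv b ((ω * Complex.exp (-s)) ^ 2 ^ (m + 1)))⁻¹ =
          (bottcherInv b ((ω * Complex.exp (-s)) ^ 2 ^ m))⁻¹ ^ 2 + (b * (1 - b) : ℝ) := by
        intro s hs
        rw [← inv_bottcherInv_sq hb hb1 _ (pow_ne_zero _ (hz0 s)), ← pow_mul, pow_succ]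
        rw [norm_pow]
        exact pow_le_one₀ (norm_nonneg _) (hz1 s hs)
      exact ⟨_, ((hκ'.pow 2).add_const _).congr heq (heq 0 self_mem_Ici)⟩
  obtain ⟨κ', hκ'⟩ := key n
  have h1 : HasDerivWithinAt (fun s : ℝ => s / 2 ^ n) (1 / 2 ^ n) (Ici 0) 0 :=
    ((hasDerivAt_id (0 : ℝ)).div_const _).hasDerivWithinAt
  have h2 := HasDerivWithinAt.scomp (t' := Ici 0) 0 (by simpa using hκ') h1
    fun s hs => div_nonneg (by simpa using hs) (by positivity)
  refine not_hasDerivWithinAt_inv_bottcherInv hb hb1 _ (h2.congr_of_eventuallyEq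
    (Eventually.of_forall fun s => ?_) ?_)
  all_goals
    simp only [Function.comp]
    rw [mul_pow, hω, one_mul, ← Complex.exp_nat_mul]
    congr 3
    push_cast
    field_simp

/-- Truncate the binary expansion of the angle. -/
lemma exists_root_of_unity_mem_ball {ζ : ℂ} (hζ : ‖ζ‖ = 1) {r : ℝ} (hr : 0 < r) :
    ∃ (ω : ℂ) (n : ℕ), ω ^ 2 ^ n = 1 ∧ ω ∈ ball ζ r := by
  -- The added full turn makes `α` nonnegative, as the natural-number floor requires.
  set α : ℝ := Complex.arg ζ / (2 * Real.pi) + 1 with hα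
  have hα0 : 0 ≤ α := by
    have := Complex.neg_pi_lt_arg ζ
    have hp := Real.pi_pos
    have h2 : -1 ≤ Complex.arg ζ / (2 * Real.pi) := by
      rw [le_div_iff₀ (by positivity)]
      linarith
    linarith
  have hζα : Complex.exp (2 * Real.pi * Complex.I * α) = ζ := by
    have h1 : (2 * Real.pi * Complex.I * α : ℂ) =
        Complex.arg ζ * Complex.I + 2 * Real.pi * Complex.I := by
      have := Complex.ofReal_ne_zero.2 Real.pi_ne_zero
      rw [hα]
      push_cast
      field_simp
    rw [h1, Complex.exp_periodic]
    simpa [hζ] using Complex.norm_mul_exp_arg_mul_I ζ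
  have h1 : Tendsto (fun n : ℕ => (⌊α * (2 : ℝ) ^ n⌋₊ : ℝ) / (2 : ℝ) ^ n) atTop (𝓝 α) :=
    (tendsto_nat_floor_mul_div_atTop hα0).comp (tendsto_pow_atTop_atTop_of_one_lt one_lt_two)
  have h2 : Continuous fun x : ℝ => Complex.exp (2 * Real.pi * Complex.I * x) := by fun_prop
  have h3 := (h2.tendsto α).comp h1
  simp only [hζα] at h3
  obtain ⟨n, hn⟩ := (h3.eventually (ball_mem_nhds ζ hr)).exists
  refine ⟨_, n, ?_, hn⟩
  rw [Function.comp, ← Complex.exp_nat_mul, Complex.exp_eq_one_iff]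
  refine ⟨⌊α * (2 : ℝ) ^ n⌋₊, ?_⟩
  push_cast
  field_simp

lemma unitCircleIsSingularityBarrier_conjMap (hb : 3 / 4 < b) (hb1 : b < 1) :
    UnitCircleIsSingularityBarrier (conjMap b) := by
  rintro ζ hζ r hr ⟨F, hF, hFG⟩
  obtain ⟨ω, n, hω, hωr⟩ := exists_root_of_unity_mem_ball (by simpa using hζ) hr
  have hω1 : ‖ω‖ = 1 := by
    have : ‖ω‖ ^ 2 ^ n = 1 := by rw [← norm_pow, hω, norm_one]
    exact (pow_eq_one_iff_of_nonneg (norm_nonneg _) (by positivity)).1 this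
  have hFd := hF.differentiableAt (isOpen_ball.mem_nhds hωr)
  have hc : Continuous fun s : ℝ => ω * Complex.exp (-s) := by fun_prop
  have hc0 : ω * Complex.exp (-(0 : ℝ)) = ω := by simp
  have hball : ∀ᶠ s : ℝ in 𝓝 0, ω * Complex.exp (-s) ∈ ball ζ r :=
    (isOpen_ball.preimage hc).mem_nhds (by simpa using hωr)
  have heq : ∀ᶠ s : ℝ in 𝓝[>] 0, F (ω * Complex.exp (-s)) = conjMap b (ω * Complex.exp (-s)) := by
    filter_upwards [hball.filter_mono nhdsWithin_le_nhds, self_mem_nhdsWithin] with s hs hs0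
    refine hFG ⟨hs, ?_⟩
    rw [mem_ball_zero_iff, norm_mul, hω1, one_mul, Complex.norm_exp]
    simpa using hs0
  -- The two functions agree by hypothesis only inside the disk; at the endpoint `ω` equality
  -- follows from radial limits.
  have hval : F ω = conjMap b ω := by
    have t1 : Tendsto (fun s : ℝ => F (ω * Complex.exp (-s))) (𝓝[>] 0) (𝓝 (F ω)) := by
      refine hFd.continuousAt.tendsto.comp ?_
      simpa using (hc.tendsto 0).mono_left nhdsWithin_le_nhds
    have t2 : Tendsto (fun s : ℝ => conjMap b (ω * Complex.exp (-s))) (𝓝[>] 0)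
        (𝓝 (conjMap b ω)) := by
      refine (continuousOn_conjMap hb hb1 ω (by simp [hω1])).tendsto.comp
        (tendsto_nhdsWithin_iff.2 ⟨?_, ?_⟩)
      · simpa using (hc.tendsto 0).mono_left nhdsWithin_le_nhds
      · filter_upwards [self_mem_nhdsWithin] with s hs
        rw [mem_closedBall_zero_iff, norm_mul, hω1, one_mul]
        exact norm_exp_neg_le_one (by simpa using le_of_lt hs)
    exact tendsto_nhds_unique (t1.congr' heq) t2
  have hd : HasDerivAt (fun s : ℝ => F (ω * Complex.exp (-s))) (-ω * deriv F ω) 0 := by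
    have e1 : HasDerivAt (fun s : ℂ => F (ω * Complex.exp (-s))) (-ω * deriv F ω)
        ((0 : ℝ) : ℂ) := by
      have e2 : HasDerivAt (fun s : ℂ => ω * Complex.exp (-s)) (-ω) ((0 : ℝ) : ℂ) := by
        refine ((hasDerivAt_neg ((0 : ℝ) : ℂ)).cexp.const_mul ω).congr_deriv ?_
        simp
      have e3 : HasDerivAt F (deriv F ω) (ω * Complex.exp (-((0 : ℝ) : ℂ))) := by
        rw [hc0]; exact hFd.hasDerivAt
      exact (HasDerivAt.comp (h₂ := F) (h := fun s : ℂ => ω * Complex.exp (-s)) _ e3 e2).congr_deriv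
        (by ring)
    exact e1.comp_ofReal
  refine not_hasDerivWithinAt_conjMap hb hb1 hω (-ω * deriv F ω)
    (hd.hasDerivWithinAt.congr_of_eventuallyEq ?_ (by simp [hval]))
  rw [← Ioi_insert, nhdsWithin_insert]
  exact eventually_sup.2 ⟨by simp [hval], heq.mono fun s hs => hs.symm⟩

end Barrier

/-! ### The Koenigs function at the fixed point -/

section Koenigs

variable {b : ℝ}

lemma exp_neg_log_ofReal (hb : 0 < b) : Complex.exp (-(Real.log b : ℝ)) = (b⁻¹ : ℝ) := by
  rw [← Complex.ofReal_neg, ← Complex.ofReal_exp, Real.exp_neg, Real.exp_log hb]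

lemma logBranch_fixed (hb : 3 / 4 < b) : logBranch b 1 (Real.log b : ℝ) = (Real.log b : ℝ) := by
  have h0 : b ≠ 0 := by linarith
  have h : (1 : ℂ) - (b * (1 - b) : ℝ) * 1 * (b⁻¹ : ℝ) = (b : ℝ) := by
    have : (b : ℂ) ≠ 0 := by exact_mod_cast h0
    push_cast
    field_simp
    ring
  rw [logBranch, exp_neg_log_ofReal (by linarith), h, ← Complex.ofReal_log (by linarith)]
  ring

lemma log_le_re_log (hb : 3 / 4 < b) : Real.log (3 / 4) ≤ ((Real.log b : ℝ) : ℂ).re :=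
  log_three_fourths_le hb

lemma log_le_re_iterate (hb : 3 / 4 < b) (hb1 : b < 1) {v : ℂ} (hv : Real.log (3 / 4) ≤ v.re)
    (n : ℕ) : Real.log (3 / 4) ≤ ((logBranch b 1)^[n] v).re := by
  induction n with
  | zero => exact hv
  | succ n ih =>
    rw [Function.iterate_succ_apply']
    exact log_le_re_logBranch le_rfl hb.le hb1 (by simp) ih

lemma norm_iterate_sub_log_le (hb : 3 / 4 < b) (hb1 : b < 1) {v : ℂ}
    (hv : Real.log (3 / 4) ≤ v.re) (n : ℕ) :
    ‖(logBranch b 1)^[n] v - (Real.log b : ℝ)‖ ≤ (2 / 3) ^ n * ‖v - (Real.log b : ℝ)‖ := by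
  induction n with
  | zero => simp
  | succ n ih =>
    have h := norm_logBranch_sub_le (y := 1) le_rfl hb.le hb1 (by simp)
      (log_le_re_iterate hb hb1 hv n) (log_le_re_log hb)
    rw [logBranch_fixed hb] at h
    rw [Function.iterate_succ_apply']
    calc _ ≤ (2 * (3 / 4))⁻¹ * ‖(logBranch b 1)^[n] v - (Real.log b : ℝ)‖ := h
      _ ≤ (2 * (3 / 4))⁻¹ * ((2 / 3) ^ n * ‖v - (Real.log b : ℝ)‖) := by gcongr
      _ = _ := by rw [pow_succ]; ring

/-- The derivative at `log b` is 1/(2b). On the half-plane the derivative differs from it by at most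
(3/16)(4/3) times the distance to `log b`, so the mean value inequality gives a quadratic error. -/
lemma norm_logBranch_sub_linear_le (hb : 3 / 4 < b) (hb1 : b < 1) {v : ℂ}
    (hv : Real.log (3 / 4) ≤ v.re) :
    ‖logBranch b 1 v - (Real.log b : ℝ) - (v - (Real.log b : ℝ)) / (2 * b)‖ ≤
      ‖v - (Real.log b : ℝ)‖ ^ 2 := by
  set v₀ : ℂ := ((Real.log b : ℝ) : ℂ) with hv₀
  have hb0 : (b : ℂ) ≠ 0 := by
    have : b ≠ 0 := by linarith
    exact_mod_cast this
  have key := Convex.norm_image_sub_le_of_norm_hasDerivWithin_le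
    (s := {p : ℂ | Real.log (3 / 4) ≤ p.re} ∩ closedBall v₀ ‖v - v₀‖)
    (f := fun p => logBranch b 1 p - p / (2 * b))
    (f' := fun p => 1 / (2 * (1 - (b * (1 - b) : ℝ) * 1 * Complex.exp (-p))) - 1 / (2 * b))
    (x := v₀) (y := v) (C := ‖v - v₀‖)
    (fun p hp => ((hasDerivAt_logBranch le_rfl hb.le hb1 (by simp) hp.1).sub
      ((hasDerivAt_id p).div_const _)).hasDerivWithinAt)
    (fun p hp => ?_) ((convex_halfSpace_re_ge _).inter (convex_closedBall _ _))
    ⟨log_le_re_log hb, by simp⟩ ⟨hv, by simp [dist_eq_norm]⟩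
  · rw [logBranch_fixed hb] at key
    calc _ = ‖logBranch b 1 v - v / (2 * b) - (v₀ - v₀ / (2 * b))‖ := by
          congr 1; field_simp; ring
      _ ≤ _ := by rw [pow_two]; exact key
  · obtain ⟨hp1, hp2⟩ := hp
    have hD := le_norm_one_sub_branch_term (y := 1) le_rfl hb.le hb1 (by simp) hp1
    have hD0 := norm_pos_iff.1 ((by norm_num : (0 : ℝ) < 3 / 4).trans_le hD)
    have he := norm_exp_neg_sub_exp_neg_le hp1 (log_le_re_log hb)
    rw [exp_neg_log_ofReal (by linarith)] at he
    have heq : 1 / (2 * (1 - (b * (1 - b) : ℝ) * 1 * Complex.exp (-p))) - 1 / (2 * b) =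
        (b * (1 - b) : ℝ) * (Complex.exp (-p) - (b⁻¹ : ℝ)) /
          (2 * b * (1 - (b * (1 - b) : ℝ) * 1 * Complex.exp (-p))) := by
      rw [div_sub_div _ _ (mul_ne_zero two_ne_zero hD0) (mul_ne_zero two_ne_zero hb0),
        div_eq_div_iff (mul_ne_zero (mul_ne_zero two_ne_zero hD0) (mul_ne_zero two_ne_zero hb0))
          (mul_ne_zero (mul_ne_zero two_ne_zero hb0) hD0)]
      push_cast
      field_simp
      ring
    have hc : 0 ≤ b * (1 - b) := mul_nonneg (by linarith) (by linarith)
    rw [heq, norm_div, norm_mul, norm_mul, norm_mul, Complex.norm_real, Complex.norm_real,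
      Real.norm_of_nonneg hc, Real.norm_of_nonneg (by linarith : 0 ≤ b), Complex.norm_ofNat,
      div_le_iff₀ (by positivity)]
    rw [mem_closedBall, dist_eq_norm] at hp2
    have h1 : b * (1 - b) ≤ 3 / 16 := by nlinarith
    have h2 : 1 ≤ 2 * b * ‖1 - (b * (1 - b) : ℝ) * 1 * Complex.exp (-p)‖ := by nlinarith
    calc _ ≤ 3 / 16 * (4 / 3 * ‖v - v₀‖) := by
          gcongr
          exact he.trans (by gcongr)
      _ ≤ ‖v - v₀‖ * 1 := by nlinarith [norm_nonneg (v - v₀)]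
      _ ≤ _ := by gcongr

/-- The approximations of the Koenigs function of `logBranch b 1` at its fixed point. -/
noncomputable def koenigsApprox (b : ℝ) (n : ℕ) (v : ℂ) : ℂ :=
  (2 * b : ℝ) ^ n * ((logBranch b 1)^[n] v - (Real.log b : ℝ))

/-- The quadratic error after `n` steps is of size (2/3)²ⁿ, against the growth (2b)ⁿ⁺¹ ≤ 2ⁿ⁺¹; the
resulting ratio is 2 · (2/3)² = 8/9. -/
lemma norm_koenigsApprox_succ_sub_le (hb : 3 / 4 < b) (hb1 : b < 1) {v : ℂ}
    (hv : Real.log (3 / 4) ≤ v.re) (n : ℕ) :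
    ‖koenigsApprox b n v - koenigsApprox b (n + 1) v‖ ≤
      2 * ‖v - (Real.log b : ℝ)‖ ^ 2 * (8 / 9) ^ n := by
  have h1 := norm_logBranch_sub_linear_le hb hb1 (log_le_re_iterate hb hb1 hv n)
  have h2 := norm_iterate_sub_log_le hb hb1 hv n
  have hb0 : (b : ℂ) ≠ 0 := by
    have : b ≠ 0 := by linarith
    exact_mod_cast this
  have heq : koenigsApprox b n v - koenigsApprox b (n + 1) v = -((2 * b : ℝ) ^ (n + 1)) *
      (logBranch b 1 ((logBranch b 1)^[n] v) - (Real.log b : ℝ) -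
        ((logBranch b 1)^[n] v - (Real.log b : ℝ)) / (2 * b)) := by
    rw [koenigsApprox, koenigsApprox, Function.iterate_succ_apply']
    push_cast
    field_simp
    ring
  rw [heq, norm_mul, norm_neg, norm_pow, Complex.norm_real, Real.norm_of_nonneg (by linarith)]
  calc _ ≤ 2 ^ (n + 1) * ((2 / 3) ^ n * ‖v - (Real.log b : ℝ)‖) ^ 2 := by
        gcongr
        · linarith
        · exact h1.trans (by gcongr)
    _ = 2 * ‖v - (Real.log b : ℝ)‖ ^ 2 * (2 * (2 / 3) ^ 2) ^ n := by
        rw [mul_pow, mul_pow 2, ← pow_mul, ← pow_mul, mul_comm n 2, pow_succ]; ring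
    _ = _ := by norm_num

/-- The Koenigs function of `logBranch b 1` at its fixed point `log b`. -/
noncomputable def koenigs (b : ℝ) (v : ℂ) : ℂ := limUnder atTop fun n => koenigsApprox b n v

lemma tendsto_koenigsApprox (hb : 3 / 4 < b) (hb1 : b < 1) {v : ℂ}
    (hv : Real.log (3 / 4) ≤ v.re) :
    Tendsto (fun n => koenigsApprox b n v) atTop (𝓝 (koenigs b v)) := by
  refine CauchySeq.tendsto_limUnder (cauchySeq_of_le_geometric (8 / 9)
    (2 * ‖v - (Real.log b : ℝ)‖ ^ 2) (by norm_num) fun n => ?_)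
  rw [dist_eq_norm]
  exact norm_koenigsApprox_succ_sub_le hb hb1 hv n

lemma dist_koenigsApprox_le (hb : 3 / 4 < b) (hb1 : b < 1) {v : ℂ}
    (hv : Real.log (3 / 4) ≤ v.re) (n : ℕ) :
    dist (koenigsApprox b n v) (koenigs b v) ≤
      2 * ‖v - (Real.log b : ℝ)‖ ^ 2 * (8 / 9) ^ n / (1 - 8 / 9) := by
  refine dist_le_of_le_geometric_of_tendsto _ _ (by norm_num) (fun n => ?_)
    (tendsto_koenigsApprox hb hb1 hv) n
  rw [dist_eq_norm]
  exact norm_koenigsApprox_succ_sub_le hb hb1 hv n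

lemma koenigs_logBranch (hb : 3 / 4 < b) (hb1 : b < 1) {v : ℂ}
    (hv : Real.log (3 / 4) ≤ v.re) :
    (2 * b : ℝ) * koenigs b (logBranch b 1 v) = koenigs b v := by
  have h1 := (tendsto_koenigsApprox hb hb1
    (log_le_re_logBranch (y := 1) le_rfl hb.le hb1 (by simp) hv)).const_mul ((2 * b : ℝ) : ℂ)
  have h2 := (tendsto_koenigsApprox hb hb1 hv).comp (tendsto_add_atTop_nat 1)
  refine tendsto_nhds_unique h1 (h2.congr fun n => ?_)
  simp only [Function.comp, koenigsApprox, Function.iterate_succ_apply]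
  ring

lemma differentiableOn_koenigsApprox (hb : 3 / 4 < b) (hb1 : b < 1) (n : ℕ) :
    DifferentiableOn ℂ (koenigsApprox b n) {v | Real.log (3 / 4) < v.re} := by
  refine (DifferentiableOn.sub_const ?_ _).const_mul _
  induction n with
  | zero => exact differentiableOn_id
  | succ n ih =>
    rw [Function.iterate_succ']
    intro v hv
    exact (hasDerivAt_logBranch le_rfl hb.le hb1 (by simp)
      (log_le_re_iterate hb hb1 (le_of_lt hv) n)).differentiableAt.comp_differentiableWithinAt v
      (ih v hv)

lemma isOpen_log_lt_re : IsOpen {v : ℂ | Real.log (3 / 4) < v.re} :=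
  isOpen_lt continuous_const Complex.continuous_re

lemma differentiableOn_koenigs (hb : 3 / 4 < b) (hb1 : b < 1) :
    DifferentiableOn ℂ (koenigs b) {v | Real.log (3 / 4) < v.re} := by
  refine TendstoLocallyUniformlyOn.differentiableOn (F := koenigsApprox b) (φ := atTop) ?_
    (Eventually.of_forall (differentiableOn_koenigsApprox hb hb1)) isOpen_log_lt_re
  rw [Metric.tendstoLocallyUniformlyOn_iff]
  intro ε hε v hv
  refine ⟨_, inter_mem_nhdsWithin _ (ball_mem_nhds v one_pos), ?_⟩
  have h : Tendsto (fun n : ℕ => 2 * (‖v - (Real.log b : ℝ)‖ + 1) ^ 2 * (8 / 9 : ℝ) ^ n /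
      (1 - 8 / 9)) atTop (𝓝 0) := by
    have := ((tendsto_pow_atTop_nhds_zero_of_lt_one (r := (8 / 9 : ℝ)) (by norm_num)
      (by norm_num)).const_mul (2 * (‖v - (Real.log b : ℝ)‖ + 1) ^ 2)).div_const (1 - 8 / 9)
    simpa using this
  filter_upwards [h.eventually_lt_const hε] with n hn w hw
  rw [dist_comm]
  refine (dist_koenigsApprox_le hb hb1 (le_of_lt hw.1) n).trans_lt (lt_of_le_of_lt ?_ hn)
  have hw2 : ‖w - (Real.log b : ℝ)‖ ≤ ‖v - (Real.log b : ℝ)‖ + 1 := by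
    have h3 := norm_add_le (v - (Real.log b : ℝ)) (w - v)
    rw [sub_add_sub_cancel'] at h3
    have h4 := hw.2
    rw [mem_ball, dist_eq_norm] at h4
    linarith
  gcongr

lemma koenigs_log (hb : 3 / 4 < b) (hb1 : b < 1) : koenigs b (Real.log b : ℝ) = 0 := by
  have h := dist_koenigsApprox_le hb hb1 (log_le_re_log hb) 0
  simpa [koenigsApprox, dist_eq_norm] using h

lemma hasDerivAt_koenigs (hb : 3 / 4 < b) (hb1 : b < 1) :
    HasDerivAt (koenigs b) 1 (Real.log b : ℝ) := by
  rw [hasDerivAt_iff_isLittleO, koenigs_log hb hb1]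
  have hU : {v : ℂ | Real.log (3 / 4) < v.re} ∈ 𝓝 ((Real.log b : ℝ) : ℂ) :=
    isOpen_log_lt_re.mem_nhds (Real.log_lt_log (by norm_num) hb)
  have h1 : (fun v : ℂ => koenigs b v - 0 - (v - (Real.log b : ℝ)) • (1 : ℂ)) =O[𝓝 ((Real.log b : ℝ) : ℂ)]
      fun v : ℂ => (v - (Real.log b : ℝ)) ^ 2 := by
    -- The distance bound at `n = 0` has constant 2 / (1 - 8/9) = 18.
    refine Asymptotics.IsBigO.of_bound 18 ?_
    filter_upwards [hU] with v hv
    have h := dist_koenigsApprox_le hb hb1 (le_of_lt hv) 0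
    rw [koenigsApprox, dist_comm, dist_eq_norm, pow_zero, one_mul, pow_zero, mul_one,
      Function.iterate_zero, id] at h
    rw [sub_zero, smul_eq_mul, mul_one, norm_pow]
    refine h.trans (le_of_eq ?_)
    ring
  refine h1.trans_isLittleO ?_
  have h2 := Asymptotics.isLittleO_pow_sub_sub ((Real.log b : ℝ) : ℂ) one_lt_two
  exact Asymptotics.isLittleO_norm_left.1 (by simpa only [norm_pow] using h2)

end Koenigs

/-! ### Real values on the real axis -/

section Real

variable {b : ℝ}

lemma im_logBranch_eq_zero (hb : 3 / 4 < b) (hb1 : b < 1) {y : ℝ} (hy : |y| ≤ 1) {p : ℂ}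
    (hp : Real.log (3 / 4) ≤ p.re) (hi : p.im = 0) : (logBranch b y p).im = 0 := by
  obtain ⟨q, rfl⟩ : ∃ q : ℝ, p = q := ⟨p.re, Complex.ext rfl (by simp [hi])⟩
  have h := norm_branch_term_le (y := y) le_rfl hb.le hb1 (by simpa using hy) hp
  have he : ((b * (1 - b) : ℝ) : ℂ) * y * Complex.exp (-q) =
      ((b * (1 - b) * y * Real.exp (-q) : ℝ) : ℂ) := by push_cast; rfl
  rw [he, Complex.norm_real, Real.norm_eq_abs] at h
  have h1 := (abs_le.1 h).2
  rw [logBranch, he, ← Complex.ofReal_one, ← Complex.ofReal_sub,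
    ← Complex.ofReal_log (by linarith), ← Complex.ofReal_add]
  norm_cast

lemma im_bottcherLog_eq_zero (hb : 3 / 4 < b) (hb1 : b < 1) {x : ℝ} (hx : |x| ≤ 1) :
    (bottcherLog b x).im = 0 := by
  have key : ∀ n : ℕ, ∀ {x : ℝ}, |x| ≤ 1 → (bottcherApprox b n x).im = 0 := by
    intro n
    induction n with
    | zero => intro x _; rfl
    | succ n ih =>
      intro x hx
      have hx2 : |x ^ 2| ≤ 1 := by rw [abs_pow]; exact pow_le_one₀ (abs_nonneg _) hx
      rw [bottcherApprox, ← Complex.ofReal_pow]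
      exact im_logBranch_eq_zero hb hb1 hx2 ((log_three_fourths_le hb).trans
        (log_le_re_bottcherApprox hb hb1 n (by simpa using hx2))) (ih hx2)
  have h := (Complex.continuous_im.tendsto _).comp
    (tendsto_bottcherApprox hb hb1 (z := x) (by simpa using hx))
  exact tendsto_nhds_unique h (tendsto_const_nhds.congr fun n => (key n hx).symm)

lemma im_logCoord_eq_zero (hb : 3 / 4 < b) (hb1 : b < 1) {s : ℝ} (hs : 0 ≤ s) :
    (logCoord b s).im = 0 := by
  have h := im_bottcherLog_eq_zero hb hb1 (x := Real.exp (-s))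
    (by rw [abs_of_pos (Real.exp_pos _)]; exact Real.exp_le_one_iff.2 (by linarith))
  rw [logCoord, Complex.add_im, Complex.ofReal_im, zero_add]
  push_cast at h
  exact h

lemma im_koenigs_eq_zero (hb : 3 / 4 < b) (hb1 : b < 1) {v : ℂ}
    (hv : Real.log (3 / 4) ≤ v.re) (hi : v.im = 0) : (koenigs b v).im = 0 := by
  have key : ∀ n : ℕ, ((logBranch b 1)^[n] v).im = 0 := by
    intro n
    induction n with
    | zero => exact hi
    | succ n ih =>
      rw [Function.iterate_succ_apply', ← Complex.ofReal_one]
      exact im_logBranch_eq_zero hb hb1 (by simp) (log_le_re_iterate hb hb1 hv n) ih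
  have h := (Complex.continuous_im.tendsto _).comp (tendsto_koenigsApprox hb hb1 hv)
  refine tendsto_nhds_unique h (tendsto_const_nhds.congr fun n => ?_)
  rw [Function.comp, koenigsApprox, ← Complex.ofReal_pow, Complex.im_ofReal_mul, Complex.sub_im,
    key n, Complex.ofReal_im, sub_zero, mul_zero]

end Real

/-! ### Linearization near `z = 1` -/

section Linearization

variable {b : ℝ}

/-- The derivative at `log b` of the map that sends the logarithm of the inverse Böttcher
coordinate to the value of `conjMap`. -/
noncomputable def linFactor (b : ℝ) : ℝ := -(2 * (1 - b) * b / (2 * b - 1) ^ 2)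

lemma linFactor_ne_zero (hb : 3 / 4 < b) (hb1 : b < 1) : linFactor b ≠ 0 := by
  have h1 : 2 * b - 1 ≠ 0 := by linarith
  have h2 : b ≠ 0 := by linarith
  have h3 : 2 * (1 - b) ≠ 0 := by linarith
  rw [linFactor]
  exact neg_ne_zero.2 (div_ne_zero (mul_ne_zero h3 h2) (pow_ne_zero 2 h1))

/-- The linearizing coordinate, in which `s ↦ 2 * s` becomes multiplication by `2 * b`. -/
noncomputable def linCoord (b : ℝ) (s : ℂ) : ℂ := linFactor b * koenigs b (logCoord b s)

lemma linCoord_two_mul (hb : 3 / 4 < b) (hb1 : b < 1) {s : ℂ} (hs : 0 ≤ s.re) :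
    linCoord b (2 * s) = (2 * b : ℝ) * linCoord b s := by
  have hs2 : 0 ≤ (2 * s).re := by simpa using hs
  have h := koenigs_logBranch hb hb1 ((log_three_fourths_le hb).trans
    (log_le_re_logCoord hb hb1 hs2))
  rw [linCoord, linCoord, logCoord_eq hb hb1 hs, ← h]
  ring

lemma differentiableOn_linCoord (hb : 3 / 4 < b) (hb1 : b < 1) :
    DifferentiableOn ℂ (linCoord b) {s | 0 < s.re} := by
  refine ((differentiableOn_koenigs hb hb1).comp ?_ fun s hs => ?_).const_mul _
  · refine differentiableOn_id.add ((differentiableOn_bottcherLog hb hb1).comp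
      (by fun_prop) fun s hs => ?_)
    rw [mem_ball_zero_iff, Complex.norm_exp, Complex.neg_re]
    exact Real.exp_lt_one_iff.2 (neg_lt_zero.2 hs)
  · exact (Real.log_lt_log (by norm_num) hb).trans_le (log_le_re_logCoord hb hb1 (le_of_lt hs))

lemma im_linCoord_eq_zero (hb : 3 / 4 < b) (hb1 : b < 1) {s : ℝ} (hs : 0 ≤ s) :
    (linCoord b s).im = 0 := by
  have := im_koenigs_eq_zero hb hb1 ((log_three_fourths_le hb).trans
    (log_le_re_logCoord hb hb1 (s := s) (by simpa using hs))) (im_logCoord_eq_zero hb hb1 hs)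
  rw [linCoord, Complex.im_ofReal_mul, this, mul_zero]

/-- The exponential determines the value only modulo 2πi; reality removes the ambiguity. -/
lemma logCoord_zero (hb : 3 / 4 < b) (hb1 : b < 1) : logCoord b 0 = (Real.log b : ℝ) := by
  have h1 : Complex.exp (-logCoord b 0) = (b⁻¹ : ℝ) := by
    rw [exp_neg_logCoord, neg_zero, Complex.exp_zero, ← inv_inv (bottcherInv b 1),
      inv_bottcherInv_one hb hb1, Complex.ofReal_inv]
  have h2 : (logCoord b 0).im = 0 := by simpa using im_logCoord_eq_zero hb hb1 (s := 0) le_rfl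
  have h3 : (logCoord b 0).re = Real.log b := by
    have := congrArg norm h1
    rw [Complex.norm_exp, Complex.neg_re, Complex.norm_real, Real.norm_of_nonneg
      (inv_nonneg.2 (by linarith)), ← Real.exp_log (show 0 < b by linarith), ← Real.exp_neg,
      Real.exp_eq_exp, Real.exp_log (by linarith)] at this
    linarith
  exact Complex.ext h3 h2

/-- `Φ` is `M` composed with the local inverse of `μ`, where `M` expresses `conjMap` through log w
and `μ` is the rescaled Koenigs function. Both have derivative `linFactor b` at `log b`, whence
Φ'(0) = 1. -/
lemma exists_linearization (hb : 3 / 4 < b) (hb1 : b < 1) :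
    ∃ (Φ : ℂ → ℂ) (ρ : ℝ), 0 < ρ ∧ DifferentiableOn ℂ Φ (ball 0 ρ) ∧
      Φ 0 = (2 * (1 - b) / (2 * b - 1) : ℝ) ∧ deriv Φ 0 = 1 ∧
      ∃ δ > 0, ∀ s : ℂ, 0 ≤ s.re → ‖s‖ < δ →
        ‖linCoord b s‖ < ρ ∧ conjMap b (Complex.exp (-s)) = Φ (linCoord b s) := by
  set v₀ : ℂ := ((Real.log b : ℝ) : ℂ) with hv₀
  have hb0 : (b : ℂ) ≠ 0 := by
    have : b ≠ 0 := by linarith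
    exact_mod_cast this
  have hb2 : (2 * b - 1 : ℂ) ≠ 0 := by
    have : 2 * b - 1 ≠ 0 := by linarith
    exact_mod_cast this
  have hD : (linFactor b : ℂ) ≠ 0 := by exact_mod_cast linFactor_ne_zero hb hb1
  set M : ℂ → ℂ := fun v => (2 * (1 - b) : ℝ) * Complex.exp (-v) /
    (1 - (1 - b : ℝ) * Complex.exp (-v)) with hM
  have hden : 1 - (1 - b : ℝ) * Complex.exp (-v₀) ≠ 0 := by
    rw [exp_neg_log_ofReal (by linarith)]
    have : 1 - ((1 - b : ℝ) : ℂ) * (b⁻¹ : ℝ) = (2 * b - 1) / b := by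
      push_cast; field_simp; ring
    rw [this]
    exact div_ne_zero hb2 hb0
  have hMd : HasDerivAt M (linFactor b) v₀ := by
    have he : HasDerivAt (fun v : ℂ => Complex.exp (-v)) (-Complex.exp (-v₀)) v₀ :=
      (hasDerivAt_neg v₀).cexp.congr_deriv (by ring)
    refine ((he.const_mul _).fun_div ((he.const_mul _).const_sub 1) hden).congr_deriv ?_
    rw [exp_neg_log_ofReal (by linarith)] at *
    rw [linFactor, div_eq_iff (pow_ne_zero 2 hden)]
    push_cast
    field_simp
    ring
  have hMan : AnalyticAt ℂ M v₀ := by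
    have : AnalyticAt ℂ (fun v : ℂ => Complex.exp (-v)) v₀ := by fun_prop
    exact (analyticAt_const.mul this).div (analyticAt_const.sub (analyticAt_const.mul this)) hden
  have hU : {v : ℂ | Real.log (3 / 4) < v.re} ∈ 𝓝 v₀ :=
    isOpen_log_lt_re.mem_nhds (Real.log_lt_log (by norm_num) hb)
  set μ : ℂ → ℂ := fun v => linFactor b * koenigs b v with hμ
  have hμan : AnalyticAt ℂ μ v₀ :=
    analyticAt_const.mul ((differentiableOn_koenigs hb hb1).analyticAt hU)
  have hμd : HasDerivAt μ (linFactor b) v₀ :=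
    ((hasDerivAt_koenigs hb hb1).const_mul _).congr_deriv (mul_one _)
  have hμ' : deriv μ v₀ ≠ 0 := by rwa [hμd.deriv]
  have hμ0 : μ v₀ = 0 := by simp [hμ, hv₀, koenigs_log hb hb1]
  set I := hμan.hasStrictDerivAt.localInverse _ _ _ hμ' with hI
  have hIan : AnalyticAt ℂ I 0 := by
    have := hμan.analyticAt_localInverse hμ'
    rwa [hμ0] at this
  have hIl : ∀ᶠ v in 𝓝 v₀, I (μ v) = v :=
    (hμan.hasStrictDerivAt.hasStrictFDerivAt_equiv hμ').eventually_left_inverse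
  have hI0 : I 0 = v₀ := by
    have := hIl.self_of_nhds
    rwa [hμ0] at this
  have hId : HasDerivAt I (linFactor b : ℂ)⁻¹ 0 := by
    have := (hμan.hasStrictDerivAt.to_localInverse hμ').hasDerivAt
    rw [hμ0] at this
    rw [← hμd.deriv]
    exact this
  have hΦan : AnalyticAt ℂ (fun y => M (I y)) 0 := by
    refine AnalyticAt.fun_comp ?_ hIan
    rwa [hI0]
  obtain ⟨ρ, hρ, hΦρ⟩ := hΦan.exists_ball_analyticOnNhd
  refine ⟨fun y => M (I y), ρ, hρ, hΦρ.differentiableOn, ?_, ?_, ?_⟩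
  · simp only [hI0, hM]
    rw [exp_neg_log_ofReal (by linarith)] at *
    push_cast at *
    rw [div_eq_div_iff hden hb2]
    field_simp
    ring
  · have h1 : HasDerivAt M (linFactor b) (I 0) := by rwa [hI0]
    exact (h1.comp 0 hId).deriv.trans (mul_inv_cancel₀ hD)
  · have h1 : Tendsto (logCoord b) (𝓝[{s | 0 ≤ s.re}] 0) (𝓝 v₀) := by
      have h2 : ContinuousOn (logCoord b) {s | 0 ≤ s.re} :=
        continuousOn_id.add ((continuousOn_bottcherLog hb hb1).comp (by fun_prop)
          fun s hs => by simpa using norm_exp_neg_le_one hs)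
      have h3 := h2 0 (by simp)
      rwa [ContinuousWithinAt, logCoord_zero hb hb1] at h3
    have h2 : ∀ᶠ v in 𝓝 v₀, ‖μ v‖ < ρ := by
      have := hμan.continuousAt.norm
      refine this.eventually_lt continuousAt_const ?_
      simpa [hμ0] using hρ
    have h3 := h1.eventually (h2.and hIl)
    rw [eventually_nhdsWithin_iff, Metric.eventually_nhds_iff] at h3
    obtain ⟨δ, hδ, h4⟩ := h3
    refine ⟨δ, hδ, fun s hs hsδ => ?_⟩
    obtain ⟨h5, h6⟩ := h4 (by simpa using hsδ) hs
    refine ⟨h5, ?_⟩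
    change _ = M (I (μ (logCoord b s)))
    rw [h6, hM, conjMap, ← exp_neg_logCoord]

end Linearization

/-! ### Taylor and Fourier coefficients with geometric bounds -/

lemma exists_taylor_coeff {f : ℂ → ℂ} {ρ R M : ℝ} (hR : 0 < R) (hRρ : R < ρ)
    (hf : DifferentiableOn ℂ f (ball 0 ρ)) (hM : ∀ z ∈ closedBall (0 : ℂ) R, ‖f z‖ ≤ M) :
    ∃ c : ℕ → ℂ, c 0 = f 0 ∧ (∀ n, ‖c n‖ ≤ M / R ^ n) ∧
      ∀ z ∈ ball (0 : ℂ) ρ, HasSum (fun n => c n * z ^ n) (f z) := by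
  refine ⟨fun n => (n.factorial : ℂ)⁻¹ * iteratedDeriv n f 0, by simp, fun n => ?_, fun z hz => ?_⟩
  · have h := Complex.norm_iteratedDeriv_le_of_forall_mem_sphere_norm_le n hR
      ((hf.mono (closedBall_subset_ball hRρ)).diffContOnCl_ball subset_rfl)
      fun z hz => hM z (sphere_subset_closedBall hz)
    rw [norm_mul, norm_inv, Complex.norm_natCast]
    have h0 : (0 : ℝ) < n.factorial := by exact_mod_cast n.factorial_pos
    rw [inv_mul_le_iff₀ h0]
    exact h.trans (le_of_eq (by ring))
  · have h := Complex.hasSum_taylorSeries_on_ball hf hz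
    refine h.congr_fun fun n => ?_
    simp only [smul_eq_mul, sub_zero]
    ring

lemma summable_pow_natAbs {q : ℝ} (h0 : 0 ≤ q) (h1 : q < 1) :
    Summable fun l : ℤ => q ^ l.natAbs := by
  rw [summable_int_iff_summable_nat_and_neg]
  simpa using summable_geometric_of_lt_one h0 h1

section Fourier

variable {F : ℂ → ℂ} {P τ σ M : ℝ}

lemma norm_exp_two_pi_mul (l : ℤ) (u : ℂ) (P : ℝ) :
    ‖Complex.exp (2 * Real.pi * Complex.I * l * u / P)‖ =
      Real.exp (-(2 * Real.pi / P * (l * u.im))) := by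
  rw [Complex.norm_exp]
  congr 1
  have : (2 * Real.pi * Complex.I * l * u / P : ℂ) =
      ((2 * Real.pi / P * l : ℝ) : ℂ) * (Complex.I * u) := by
    push_cast; ring
  rw [this, Complex.re_ofReal_mul, Complex.I_mul_re]
  ring

lemma exp_two_pi_mul_add_period (l : ℤ) (u : ℂ) (hP : P ≠ 0) :
    Complex.exp (2 * Real.pi * Complex.I * l * (u + P) / P) =
      Complex.exp (2 * Real.pi * Complex.I * l * u / P) := by
  rw [Complex.exp_eq_exp_iff_exists_int]
  refine ⟨l, ?_⟩
  have : (P : ℂ) ≠ 0 := by exact_mod_cast hP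
  field_simp

/-- The Fourier coefficients of a periodic holomorphic function in a strip can be computed along
any horizontal line. -/
lemma integral_horizontal_eq (hP : 0 < P) (hF : DifferentiableOn ℂ F {u | |u.im| < τ})
    (hper : ∀ u : ℂ, |u.im| < τ → F (u + P) = F u) (l : ℤ) {y : ℝ} (hy : |y| < τ) :
    ∫ x in (0 : ℝ)..P, F x * Complex.exp (2 * Real.pi * Complex.I * (-l : ℤ) * x / P) =
      ∫ x in (0 : ℝ)..P, F (x + y * Complex.I) *
        Complex.exp (2 * Real.pi * Complex.I * (-l : ℤ) * (x + y * Complex.I) / P) := by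
  set g : ℂ → ℂ := fun u => F u * Complex.exp (2 * Real.pi * Complex.I * (-l : ℤ) * u / P)
    with hg
  have hgd : DifferentiableOn ℂ g {u | |u.im| < τ} := hF.mul (by fun_prop)
  have hτ : ∀ t ∈ uIcc 0 y, |t| < τ := fun t ht => by
    have := abs_sub_left_of_mem_uIcc ht
    simp only [sub_zero] at this
    exact this.trans_lt hy
  have h := Complex.integral_boundary_rect_eq_zero_of_differentiableOn g 0 (P + y * Complex.I)
    (hgd.mono fun u hu => hτ _ (by simpa using hu.2))
  -- By periodicity the two vertical sides of the rectangle cancel.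
  have hv : ∫ t in (0 : ℝ)..y, g (P + t * Complex.I) = ∫ t in (0 : ℝ)..y, g (t * Complex.I) := by
    refine intervalIntegral.integral_congr fun t ht => ?_
    simp only [hg]
    rw [add_comm (P : ℂ), hper _ (by simpa using hτ t ht),
      exp_two_pi_mul_add_period _ _ hP.ne']
  simp only [Complex.zero_re, Complex.zero_im, Complex.add_re, Complex.add_im, Complex.ofReal_re,
    Complex.ofReal_im, Complex.mul_re, Complex.mul_im, Complex.I_re, Complex.I_im, mul_zero,
    mul_one, zero_add, add_zero, sub_self, Complex.ofReal_zero, zero_mul, hv,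
    add_sub_cancel_right] at h
  exact sub_eq_zero.1 h

/-- Moving the line of integration to height σ or -σ, according to the sign of `l`, gives the decay.
The series at `u` is the Fourier series along the horizontal line through `u`; there the
coefficients gain at most exp(2π|l||Im u|/P), so they stay summable for |Im u| < σ. -/
lemma exists_fourier_coeff (hP : 0 < P) (hστ : σ < τ) (hσ : 0 < σ)
    (hF : DifferentiableOn ℂ F {u | |u.im| < τ})
    (hper : ∀ u : ℂ, |u.im| < τ → F (u + P) = F u)
    (hM : ∀ u : ℂ, |u.im| ≤ σ → ‖F u‖ ≤ M) :
    ∃ c : ℤ → ℂ, (∀ l, ‖c l‖ ≤ M * Real.exp (-(2 * Real.pi / P * (l.natAbs * σ)))) ∧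
      ∀ u : ℂ, |u.im| < σ →
        HasSum (fun l => c l * Complex.exp (2 * Real.pi * Complex.I * l * u / P)) (F u) := by
  have hM0 : 0 ≤ M := (norm_nonneg _).trans (hM 0 (by simpa using hσ.le))
  have hθ : 0 < 2 * Real.pi / P := by positivity
  set c : ℤ → ℂ := fun l => (1 / P : ℝ) *
    ∫ x in (0 : ℝ)..P, F x * Complex.exp (2 * Real.pi * Complex.I * (-l : ℤ) * x / P) with hc
  have hbound : ∀ (l : ℤ) (y : ℝ), |y| ≤ σ →
      ‖c l‖ ≤ M * Real.exp (2 * Real.pi / P * (l * y)) := by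
    intro l y hy
    have h1 := intervalIntegral.norm_integral_le_of_norm_le_const (a := 0) (b := P)
      (C := M * Real.exp (2 * Real.pi / P * (l * y)))
      (f := fun x : ℝ => F (x + y * Complex.I) *
        Complex.exp (2 * Real.pi * Complex.I * (-l : ℤ) * (x + y * Complex.I) / P))
      fun x _ => by
        rw [norm_mul, norm_exp_two_pi_mul]
        have e1 : ((x : ℂ) + y * Complex.I).im = y := by simp
        have e2 : -(2 * Real.pi / P * (((-l : ℤ) : ℝ) * y)) = 2 * Real.pi / P * (l * y) := by
          push_cast; ring
        rw [e1, e2]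
        exact mul_le_mul_of_nonneg_right (hM _ (by rwa [e1])) (Real.exp_pos _).le
    rw [hc]
    simp only
    rw [integral_horizontal_eq hP hF hper l (hy.trans_lt hστ), norm_mul, Complex.norm_real,
      Real.norm_of_nonneg (by positivity)]
    rw [sub_zero, abs_of_pos hP] at h1
    calc _ ≤ 1 / P * (M * Real.exp (2 * Real.pi / P * (l * y)) * P) := by gcongr
      _ = _ := by field_simp
  have hcb : ∀ l, ‖c l‖ ≤ M * Real.exp (-(2 * Real.pi / P * (l.natAbs * σ))) := by
    intro l
    rcases le_total 0 l with hl | hl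
    · refine (hbound l (-σ) (by rw [abs_neg, abs_of_pos hσ])).trans (le_of_eq ?_)
      rw [Nat.cast_natAbs, abs_of_nonneg hl]
      congr 2
      ring
    · refine (hbound l σ (by rw [abs_of_pos hσ])).trans (le_of_eq ?_)
      rw [Nat.cast_natAbs, abs_of_nonpos hl]
      congr 2
      push_cast
      ring
  refine ⟨c, hcb, fun u hu => ?_⟩
  have hfact : Fact (0 < P) := ⟨hP⟩
  set y := u.im with hy
  have hyτ : |y| < τ := hu.trans hστ
  have him : ∀ x : ℝ, ((x : ℂ) + y * Complex.I).im = y := fun x => by simp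
  have hp : Function.Periodic (fun x : ℝ => F (x + y * Complex.I)) P := by
    intro x
    have := hper (x + y * Complex.I) (by rwa [him])
    simp only
    rw [← this]
    congr 1
    push_cast
    ring
  have hcont : Continuous fun x : ℝ => F (x + y * Complex.I) :=
    hF.continuousOn.comp_continuous (by fun_prop) fun x => by
      change |((x : ℂ) + y * Complex.I).im| < τ
      rw [him]; exact hyτ
  set f : C(AddCircle P, ℂ) := ⟨hp.lift, continuous_coinduced_dom.mpr hcont⟩ with hf
  have hfx : ∀ x : ℝ, f (x : AddCircle P) = F (x + y * Complex.I) := fun x => rfl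
  have hcoeff : ∀ l, fourierCoeff f l =
      c l * Complex.exp (2 * Real.pi * Complex.I * l * (y * Complex.I) / P) := by
    intro l
    rw [fourierCoeff_eq_intervalIntegral f l 0, zero_add, hc]
    simp only
    rw [integral_horizontal_eq hP hF hper l hyτ, mul_assoc, ← intervalIntegral.integral_mul_const,
      Complex.real_smul]
    congr 1
    refine intervalIntegral.integral_congr fun x _ => ?_
    rw [fourier_coe_apply, hfx, smul_eq_mul, mul_assoc (F _), ← Complex.exp_add, mul_comm]
    congr 2
    push_cast
    ring
  have hsum : Summable (fourierCoeff f) := by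
    refine Summable.of_norm_bounded (g := fun l : ℤ =>
      M * Real.exp (-(2 * Real.pi / P * (σ - |y|))) ^ l.natAbs)
      ((summable_pow_natAbs (Real.exp_pos _).le (Real.exp_lt_one_iff.2 ?_)).mul_left M)
      fun l => ?_
    · have := mul_pos hθ (sub_pos.2 hu)
      linarith
    · rw [hcoeff, norm_mul, norm_exp_two_pi_mul]
      have e1 : ((y : ℂ) * Complex.I).im = y := by simp
      rw [e1]
      calc _ ≤ M * Real.exp (-(2 * Real.pi / P * (l.natAbs * σ))) *
            Real.exp (2 * Real.pi / P * (l.natAbs * |y|)) := by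
            gcongr
            · exact hcb l
            · rw [← mul_neg]
              gcongr
              rw [Nat.cast_natAbs, Int.cast_abs, ← abs_mul]
              exact neg_le_abs _
        _ = _ := by
            rw [mul_assoc, ← Real.exp_add, ← Real.exp_nat_mul]
            congr 2
            ring
  have h := has_pointwise_sum_fourier_series_of_summable hsum (u.re : AddCircle P)
  rw [hfx, hy, Complex.re_add_im] at h
  refine h.congr_fun fun l => ?_
  rw [hcoeff, fourier_coe_apply, smul_eq_mul, mul_assoc (c l), ← Complex.exp_add, ← add_div,
    ← mul_add, add_comm ((y : ℂ) * Complex.I), hy, Complex.re_add_im]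

end Fourier

/-! ### The periodic factor -/

section PeriodicFactor

variable {b : ℝ}

/-- The periodic factor `u ↦ exp (-β * u) * T (exp u)` of the linearizing coordinate `T`. -/
noncomputable def periodicFactor (b : ℝ) (u : ℂ) : ℂ :=
  Complex.exp (-(Real.logb 2 (2 * b) * u)) * linCoord b (Complex.exp u)

lemma exp_mul_periodicFactor (b : ℝ) (u : ℂ) :
    Complex.exp (Real.logb 2 (2 * b) * u) * periodicFactor b u = linCoord b (Complex.exp u) := by
  rw [periodicFactor, ← mul_assoc, ← Complex.exp_add, add_neg_cancel, Complex.exp_zero, one_mul]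

lemma re_exp_pos {u : ℂ} (hu : |u.im| < Real.pi / 2) : 0 < (Complex.exp u).re := by
  rw [Complex.exp_re]
  exact mul_pos (Real.exp_pos _) (Real.cos_pos_of_mem_Ioo (abs_lt.1 hu))

lemma differentiableOn_periodicFactor (hb : 3 / 4 < b) (hb1 : b < 1) :
    DifferentiableOn ℂ (periodicFactor b) {u | |u.im| < Real.pi / 2} :=
  DifferentiableOn.mul (by fun_prop)
    ((differentiableOn_linCoord hb hb1).comp (by fun_prop) fun _ hu => re_exp_pos hu)

/-- The factor exp(-β ln 2) = 1/(2b) cancels the multiplier of `linCoord` under doubling. -/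
lemma periodicFactor_add_log_two (hb : 3 / 4 < b) (hb1 : b < 1) {u : ℂ}
    (hu : |u.im| < Real.pi / 2) :
    periodicFactor b (u + (Real.log 2 : ℝ)) = periodicFactor b u := by
  have h2 : Complex.exp (Real.log 2 : ℝ) = 2 := by
    rw [← Complex.ofReal_exp, Real.exp_log two_pos]; norm_num
  have h3 : Complex.exp (-(Real.logb 2 (2 * b) * (Real.log 2 : ℝ))) = ((2 * b : ℝ) : ℂ)⁻¹ := by
    rw [← Complex.ofReal_mul, ← Complex.ofReal_neg, ← Complex.ofReal_exp, Real.exp_neg,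
      Real.logb, div_mul_cancel₀ _ (Real.log_pos one_lt_two).ne', Real.exp_log (by linarith),
      Complex.ofReal_inv]
  have h4 : ((2 * b : ℝ) : ℂ) ≠ 0 := by
    have : (2 * b : ℝ) ≠ 0 := by linarith
    exact_mod_cast this
  rw [periodicFactor, periodicFactor, mul_add, neg_add, Complex.exp_add, Complex.exp_add, h2, h3,
    mul_comm (Complex.exp u), linCoord_two_mul hb hb1 (re_exp_pos hu).le]
  field_simp

lemma exists_bound_periodicFactor (hb : 3 / 4 < b) (hb1 : b < 1) :
    ∃ M > 0, ∀ u : ℂ, |u.im| ≤ 1 → ‖periodicFactor b u‖ ≤ M := by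
  have hpi : 1 < Real.pi / 2 := by linarith [Real.pi_gt_three]
  have hcpt : IsCompact (Icc 0 (Real.log 2) ×ℂ Icc (-1) 1) :=
    isCompact_Icc.reProdIm isCompact_Icc
  obtain ⟨M, hM⟩ := hcpt.exists_bound_of_continuousOn
    ((differentiableOn_periodicFactor hb hb1).continuousOn.mono fun u hu =>
      (abs_le.2 hu.2).trans_lt hpi)
  refine ⟨max M 1, by positivity, fun u hu => ?_⟩
  have hp : Function.Periodic (fun x : ℝ => periodicFactor b (x + u.im * Complex.I))
      (Real.log 2) := by
    intro x
    have := periodicFactor_add_log_two hb hb1 (u := x + u.im * Complex.I)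
      (by simpa using hu.trans_lt hpi)
    simp only
    rw [← this]
    congr 1
    push_cast
    ring
  obtain ⟨x, hx, hxe⟩ := hp.exists_mem_Ico₀ (Real.log_pos one_lt_two) u.re
  simp only [Complex.re_add_im] at hxe
  rw [hxe]
  refine (hM _ ⟨?_, ?_⟩).trans (le_max_left _ _)
  · simpa using ⟨hx.1, hx.2.le⟩
  · simpa using abs_le.1 hu

lemma im_periodicFactor_eq_zero (hb : 3 / 4 < b) (hb1 : b < 1) (x : ℝ) :
    (periodicFactor b x).im = 0 := by
  have h := im_linCoord_eq_zero hb hb1 (Real.exp_pos x).le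
  rw [periodicFactor, ← Complex.ofReal_mul, ← Complex.ofReal_neg, ← Complex.ofReal_exp,
    ← Complex.ofReal_exp, Complex.im_ofReal_mul, h, mul_zero]

lemma analyticOnNhd_re_periodicFactor (hb : 3 / 4 < b) (hb1 : b < 1) :
    AnalyticOnNhd ℝ (fun x : ℝ => (periodicFactor b x).re) univ := by
  intro x _
  have hopen : IsOpen {u : ℂ | |u.im| < Real.pi / 2} :=
    isOpen_lt Complex.continuous_im.abs continuous_const
  have h1 : AnalyticAt ℝ (periodicFactor b) (x : ℂ) :=
    ((differentiableOn_periodicFactor hb hb1).analyticAt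
      (hopen.mem_nhds (by simpa using Real.pi_pos))).restrictScalars
  have h2 : AnalyticAt ℝ (fun x : ℝ => periodicFactor b x) x :=
    AnalyticAt.fun_comp (g := periodicFactor b) h1 (Complex.ofRealCLM.analyticAt x)
  exact (Complex.reCLM.analyticAt _).comp h2

end PeriodicFactor

/-! ### The expansion in powers of `t = 1 - z` -/

/-- The quotient -log(1 - t)/t extends by 1 at 0 and so has a small holomorphic logarithm η near 0.
Then log t + η(t) is a logarithm of -log(1 - t). The radius `2 * R` leaves room for Cauchy estimates
on radius `R`. -/
lemma exists_log_factor : ∃ (R : ℝ) (η : ℂ → ℂ), 0 < R ∧ R ≤ 1 / 2 ∧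
    DifferentiableOn ℂ η (ball 0 (2 * R)) ∧ (∀ t ∈ ball (0 : ℂ) (2 * R), ‖η t‖ ≤ 1 / 4) ∧
    ∀ t ∈ ball (0 : ℂ) (2 * R), -Complex.log (1 - t) = t * Complex.exp (η t) := by
  set f : ℂ → ℂ := fun t => -Complex.log (1 - t) with hf
  have hfd : DifferentiableOn ℂ f (ball 0 1) := by
    refine (DifferentiableOn.clog (by fun_prop) fun t ht => ?_).neg
    rw [sub_eq_add_neg]
    exact Complex.mem_slitPlane_of_norm_lt_one (by simpa using ht)
  have hk : DifferentiableOn ℂ (dslope f 0) (ball 0 1) :=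
    (Complex.differentiableOn_dslope (ball_mem_nhds 0 one_pos)).2 hfd
  have hk0 : dslope f 0 0 = 1 := by
    rw [dslope_same]
    have h1 : HasDerivAt (fun t : ℂ => 1 - t) (-1) 0 := (hasDerivAt_id (0 : ℂ)).const_sub 1
    have h2 := (h1.clog (by simp)).neg
    rw [sub_zero, div_one, neg_neg] at h2
    exact h2.deriv
  have hc : ContinuousAt (dslope f 0) 0 := hk.continuousOn.continuousAt (ball_mem_nhds 0 one_pos)
  have h1 : ∀ᶠ t in 𝓝 (0 : ℂ), dslope f 0 t ∈ Complex.slitPlane :=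
    hc.eventually_mem (Complex.isOpen_slitPlane.mem_nhds (by rw [hk0]; exact Complex.one_mem_slitPlane))
  have h2 : ∀ᶠ t in 𝓝 (0 : ℂ), ‖Complex.log (dslope f 0 t)‖ < 1 / 4 := by
    have := (hc.clog (by rw [hk0]; exact Complex.one_mem_slitPlane)).norm
    exact this.eventually_lt continuousAt_const (by rw [hk0]; simp)
  obtain ⟨ε, hε, h3⟩ := Metric.eventually_nhds_iff_ball.1 (h1.and h2)
  refine ⟨min (ε / 2) (1 / 2), fun t => Complex.log (dslope f 0 t), by positivity,
    min_le_right _ _, ?_, ?_, ?_⟩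
  all_goals
    have hsub : ball (0 : ℂ) (2 * min (ε / 2) (1 / 2)) ⊆ ball 0 ε ∩ ball 0 1 := by
      refine subset_inter (ball_subset_ball ?_) (ball_subset_ball ?_)
      · linarith [min_le_left (ε / 2) (1 / 2)]
      · linarith [min_le_right (ε / 2) (1 / 2)]
  · exact (hk.mono (hsub.trans inter_subset_right)).clog fun t ht => (h3 t (hsub ht).1).1
  · exact fun t ht => (h3 t (hsub ht).1).2.le
  · intro t ht
    rw [Complex.exp_log (Complex.slitPlane_ne_zero (h3 t (hsub ht).1).1)]
    have := sub_smul_dslope f 0 t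
    simp only [sub_zero, smul_eq_mul] at this
    rw [this]
    simp [hf]

section Expansion

variable {b : ℝ}

/-- The local form of `conjMap` near `1` in terms of the linearization. -/
lemma conjMap_eq_near_one {b δ ρ : ℝ} {Φ : ℂ → ℂ} (hδ : 0 < δ)
    (h : ∀ s : ℂ, 0 ≤ s.re → ‖s‖ < δ →
      ‖linCoord b s‖ < ρ ∧ conjMap b (Complex.exp (-s)) = Φ (linCoord b s)) :
    ∃ r > 0, ∀ z ∈ ball (0 : ℂ) 1 ∩ ball (1 : ℂ) r,
      ‖Complex.log z⁻¹ ^ (Real.logb 2 (2 * b) : ℂ) *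
          periodicFactor b (Complex.log (Complex.log z⁻¹))‖ < ρ ∧
      conjMap b z = Φ (Complex.log z⁻¹ ^ (Real.logb 2 (2 * b) : ℂ) *
          periodicFactor b (Complex.log (Complex.log z⁻¹))) := by
  have hc : ContinuousAt (fun z : ℂ => ‖Complex.log z⁻¹‖) 1 := by
    refine (ContinuousAt.clog (continuousAt_inv₀ one_ne_zero) ?_).norm
    rw [inv_one]
    exact Complex.one_mem_slitPlane
  have h1 : ∀ᶠ z in 𝓝 (1 : ℂ), ‖Complex.log z⁻¹‖ < δ :=
    hc.eventually_lt continuousAt_const (by simpa using hδ)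
  obtain ⟨r, hr, h2⟩ := Metric.eventually_nhds_iff_ball.1
    (h1.and (isOpen_ne.eventually_mem (one_ne_zero (α := ℂ))))
  refine ⟨r, hr, fun z hz => ?_⟩
  obtain ⟨h3, hz0⟩ := h2 z hz.2
  have hz1 : ‖z‖ < 1 := by simpa using hz.1
  have hzpos : 0 < ‖z‖ := norm_pos_iff.2 hz0
  set s := Complex.log z⁻¹ with hs
  have hre : 0 < s.re := by
    rw [hs, Complex.log_re, norm_inv]
    exact Real.log_pos ((one_lt_inv₀ hzpos).2 hz1)
  have hs0 : s ≠ 0 := by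
    rintro h0
    rw [h0, Complex.zero_re] at hre
    exact lt_irrefl _ hre
  have hexp : Complex.exp (-s) = z := by
    rw [hs, Complex.exp_neg, Complex.exp_log (inv_ne_zero hz0), inv_inv]
  have hT : s ^ (Real.logb 2 (2 * b) : ℂ) * periodicFactor b (Complex.log s) = linCoord b s := by
    rw [Complex.cpow_def_of_ne_zero hs0, mul_comm (Complex.log s), exp_mul_periodicFactor,
      Complex.exp_log hs0]
  rw [hT]
  have := h s hre.le h3
  rwa [hexp] at this

/-- The exponent `2πil/ln 2 + kβ` without its integer part. -/
noncomputable def expansionExponent (b : ℝ) (l : ℤ) (k : ℕ) : ℂ :=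
  2 * (Real.pi : ℂ) * Complex.I * (l : ℂ) / (Real.log 2 : ℂ) + (k : ℂ) * (Real.logb 2 (2 * b) : ℂ)

lemma expansionExponent_eq (b : ℝ) (l : ℤ) (k : ℕ) : expansionExponent b l k =
    ((k * Real.logb 2 (2 * b) : ℝ) : ℂ) + ((2 * Real.pi / Real.log 2 * l : ℝ) : ℂ) * Complex.I := by
  rw [expansionExponent]
  push_cast
  ring

lemma norm_expansionExponent_le (hb : 3 / 4 < b) (hb1 : b < 1) (l : ℤ) (k : ℕ) :
    ‖expansionExponent b l k‖ ≤ k + 2 * Real.pi / Real.log 2 * l.natAbs := by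
  have hP := Real.log_pos one_lt_two
  have hβ0 := (logb_pos hb).le
  have hβ1 := (logb_lt_one hb hb1).le
  rw [expansionExponent_eq]
  refine (norm_add_le _ _).trans (add_le_add ?_ (le_of_eq ?_))
  · rw [Complex.norm_real, Real.norm_of_nonneg (by positivity)]
    exact mul_le_of_le_one_right (Nat.cast_nonneg _) hβ1
  · rw [norm_mul, Complex.norm_I, mul_one, Complex.norm_real, Real.norm_eq_abs, abs_mul,
      abs_of_pos (by positivity), Nat.cast_natAbs, Int.cast_abs]

lemma norm_cpow_expansionExponent_le {t : ℂ} (ht : t ≠ 0) {δ : ℝ} (hδ : |t.arg| ≤ δ)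
    (l : ℤ) (k m : ℕ) :
    ‖t ^ (expansionExponent b l k + m)‖ ≤ (‖t‖ ^ Real.logb 2 (2 * b)) ^ k * ‖t‖ ^ m *
      Real.exp (2 * Real.pi / Real.log 2 * l.natAbs * δ) := by
  have hP := Real.log_pos one_lt_two
  have ht0 := norm_pos_iff.2 ht
  have hre : (expansionExponent b l k + m).re = Real.logb 2 (2 * b) * k + m := by
    rw [expansionExponent_eq, Complex.add_re, Complex.add_re, Complex.ofReal_re,
      Complex.re_ofReal_mul, Complex.I_re, Complex.natCast_re]
    ring
  have him : (expansionExponent b l k + m).im = 2 * Real.pi / Real.log 2 * l := by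
    rw [expansionExponent_eq, Complex.add_im, Complex.add_im, Complex.ofReal_im,
      Complex.im_ofReal_mul, Complex.I_im, Complex.natCast_im]
    ring
  rw [Complex.norm_cpow_of_ne_zero ht, hre, him, Real.rpow_add ht0, Real.rpow_mul ht0.le,
    Real.rpow_natCast, Real.rpow_natCast, div_eq_mul_inv, ← Real.exp_neg]
  gcongr
  calc -(t.arg * (2 * Real.pi / Real.log 2 * l)) = 2 * Real.pi / Real.log 2 * -(l * t.arg) := by
        ring
    _ ≤ 2 * Real.pi / Real.log 2 * (l.natAbs * δ) := by
        gcongr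
        refine (neg_le_abs _).trans ?_
        rw [abs_mul, Nat.cast_natAbs, Int.cast_abs]
        gcongr
    _ = _ := by ring

lemma summable_pow_natAbs_add {q : ℝ} (h0 : 0 ≤ q) (h1 : q < 1) :
    Summable fun p : ℤ × ℕ × ℕ => q ^ (p.1.natAbs + p.2.1 + p.2.2) := by
  have hn := summable_geometric_of_lt_one h0 h1
  have h2 := (summable_pow_natAbs h0 h1).mul_of_nonneg
    (hn.mul_of_nonneg hn (fun _ => pow_nonneg h0 _) fun _ => pow_nonneg h0 _)
    (fun _ => pow_nonneg h0 _) fun _ => mul_nonneg (pow_nonneg h0 _) (pow_nonneg h0 _)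
  refine h2.congr fun p => ?_
  rw [pow_add, pow_add, mul_assoc]

/-- A triple series, summable as a whole, can be summed in the order last, first, middle
index. -/
lemma HasSum.of_iterated {f : ℤ × ℕ × ℕ → ℂ} (hf : Summable f) {g : ℤ → ℕ → ℂ} {h : ℕ → ℂ}
    {S : ℂ} (hg : ∀ l k, HasSum (fun m => f (l, k, m)) (g l k))
    (hh : ∀ k, HasSum (fun l => g l k) (h k)) (hS : HasSum h S) : HasSum f S := by
  let e : (ℕ × ℤ) × ℕ ≃ ℤ × ℕ × ℕ :=
    ((Equiv.prodComm ℕ ℤ).prodCongr (Equiv.refl ℕ)).trans (Equiv.prodAssoc ℤ ℕ ℕ)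
  have h1 : HasSum (f ∘ e) (∑' p, f p) := e.hasSum_iff.2 hf.hasSum
  have h2 : HasSum (fun p : ℕ × ℤ => g p.2 p.1) (∑' p, f p) :=
    h1.prod_fiberwise fun p => hg p.2 p.1
  have h3 := h2.prod_fiberwise hh
  rw [← h3.unique hS]
  exact hf.hasSum

/-- Put u = log t + η(t), so that exp u = -log(1 - t). In `Φ (linCoord b (exp u))` the Taylor series
of Φ produces `k`, the Fourier series of the `k`-th power of the periodic factor produces `l`, and
exp(λu) = t^λ exp(λη(t)), with the last factor expanded in `t`, produces `m`. Fourier decay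
exp(-θ|l|) outweighs the losses exp(θ|l|/4) from η and exp(θ|l|δ) from arg t. -/
lemma exists_expansion (hb : 3 / 4 < b) (hb1 : b < 1) {Φ : ℂ → ℂ} {ρ δ₀ : ℝ} (hρ : 0 < ρ)
    (hΦ : DifferentiableOn ℂ Φ (ball 0 ρ)) (hδ₀ : 0 < δ₀)
    (hlin : ∀ s : ℂ, 0 ≤ s.re → ‖s‖ < δ₀ →
      ‖linCoord b s‖ < ρ ∧ conjMap b (Complex.exp (-s)) = Φ (linCoord b s)) :
    ∃ (C : ℤ → ℕ → ℕ → ℂ) (δ K q : ℝ),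
      (∀ l m, C l 0 m = 0) ∧ 0 < δ ∧ 0 ≤ q ∧ q < 1 ∧
      ∀ t : ℂ, t ≠ 0 → ‖t‖ < δ → |t.arg| < δ →
        (∀ l k m, ‖C l k m * t ^ (expansionExponent b l k + m)‖ ≤ K * q ^ (l.natAbs + k + m)) ∧
        HasSum (fun p : ℤ × ℕ × ℕ =>
          C p.1 p.2.1 p.2.2 * t ^ (expansionExponent b p.1 p.2.1 + p.2.2))
          (conjMap b (1 - t) - Φ 0) := by
  have hP := Real.log_pos one_lt_two
  have hβ := logb_pos hb
  set θ : ℝ := 2 * Real.pi / Real.log 2 with hθ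
  have hθ0 : 0 < θ := by positivity
  have hpi : 1 < Real.pi / 2 := by linarith [Real.pi_gt_three]
  obtain ⟨R, η, hR, hR2, hηd, hη, hηlog⟩ := exists_log_factor
  obtain ⟨M, hM0, hM⟩ := exists_bound_periodicFactor hb hb1
  obtain ⟨ρ', hρ', hρρ⟩ := exists_between hρ
  obtain ⟨B, hB⟩ := (isCompact_closedBall (0 : ℂ) ρ').exists_bound_of_continuousOn
    (hΦ.continuousOn.mono (closedBall_subset_ball hρρ))
  have hB0 : 0 ≤ B := (norm_nonneg _).trans (hB 0 (mem_closedBall_self hρ'.le))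
  obtain ⟨φ, hφ0, hφb, hφs⟩ := exists_taylor_coeff hρ' hρρ hΦ hB
  -- Each power is expanded as a periodic function in its own right, so its coefficients are bounded
  -- by M^k without convolutions.
  have hfour : ∀ k : ℕ, ∃ c : ℤ → ℂ,
      (∀ l, ‖c l‖ ≤ M ^ k * Real.exp (-(2 * Real.pi / Real.log 2 * (l.natAbs * 1)))) ∧
      ∀ u : ℂ, |u.im| < 1 → HasSum (fun l => c l *
        Complex.exp (2 * Real.pi * Complex.I * l * u / Real.log 2)) (periodicFactor b u ^ k) :=
    fun k => exists_fourier_coeff (F := fun u => periodicFactor b u ^ k) hP hpi one_pos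
      ((differentiableOn_periodicFactor hb hb1).pow k)
      (fun u hu => by simp only [periodicFactor_add_log_two hb hb1 hu])
      (fun u hu => by rw [norm_pow]; exact pow_le_pow_left₀ (norm_nonneg _) (hM u hu) k)
  choose c hcb hcs using hfour
  have hexp : ∀ (l : ℤ) (k : ℕ), ∃ e : ℕ → ℂ,
      (∀ m, ‖e m‖ ≤ Real.exp ((k + θ * l.natAbs) / 4) / R ^ m) ∧
      ∀ t ∈ ball (0 : ℂ) (2 * R),
        HasSum (fun m => e m * t ^ m) (Complex.exp (expansionExponent b l k * η t)) := by
    intro l k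
    obtain ⟨e, -, he1, he2⟩ := exists_taylor_coeff hR (by linarith : R < 2 * R)
      (f := fun t => Complex.exp (expansionExponent b l k * η t)) (hηd.const_mul _).cexp
      (M := Real.exp ((k + θ * l.natAbs) / 4)) fun t ht => by
        have h1 := hη t (closedBall_subset_ball (by linarith) ht)
        have h2 := norm_expansionExponent_le hb hb1 l k
        refine (Complex.norm_exp_le_exp_norm _).trans (Real.exp_le_exp.2 ?_)
        rw [norm_mul, div_eq_mul_one_div]
        gcongr
    exact ⟨e, he1, he2⟩
  choose e heb hes using hexp
  -- The conditions serve, in order, the decay in `l`, the decay in `m`, the domain of the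
  -- linearization (as ‖exp u‖ ≤ 2‖t‖), and the decay in `k`.
  obtain ⟨δ, hδ0, hδ4, hδR, hδδ, hδM⟩ : ∃ δ > 0, δ ≤ 1 / 4 ∧ δ ≤ R / 2 ∧ 2 * δ ≤ δ₀ ∧
      M * Real.exp (1 / 4) * δ ^ Real.logb 2 (2 * b) / ρ' ≤ 1 / 2 := by
    have h1 : Tendsto (fun δ : ℝ => M * Real.exp (1 / 4) * δ ^ Real.logb 2 (2 * b) / ρ')
        (𝓝 0) (𝓝 0) := by
      have : ContinuousAt (fun δ : ℝ => M * Real.exp (1 / 4) * δ ^ Real.logb 2 (2 * b) / ρ')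
          0 := ((Real.continuousAt_rpow_const 0 _ (Or.inr hβ.le)).const_mul _).div_const _
      simpa [ContinuousAt, Real.zero_rpow hβ.ne'] using this
    have h2 := (h1.eventually_le_const (show (0 : ℝ) < 1 / 2 by norm_num)).and
      (eventually_le_nhds (show (0 : ℝ) < min (1 / 4) (min (R / 2) (δ₀ / 2)) by positivity))
    obtain ⟨δ, ⟨h3, h4⟩, h5⟩ :=
      ((h2.filter_mono nhdsWithin_le_nhds).and (self_mem_nhdsWithin (s := Ioi (0 : ℝ)))).exists
    have h6 := le_min_iff.1 (le_min_iff.1 h4).2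
    exact ⟨δ, h5, (le_min_iff.1 h4).1, h6.1, by linarith [h6.2], h3⟩
  -- The ratios in `k` and `m` are at most 1/2; the ratio in `l` is exp(-θ(3/4 - δ)) ≤ exp(-θ/2),
  -- because δ ≤ 1/4.
  set q : ℝ := max (1 / 2) (Real.exp (-(θ / 2))) with hq
  have hq0 : 0 ≤ q := le_max_of_le_left (by norm_num)
  have hq1 : q < 1 := max_lt (by norm_num) (Real.exp_lt_one_iff.2 (by linarith))
  -- Dropping the constant term accounts for the subtraction of `Φ 0`.
  set φ' : ℕ → ℂ := fun k => if k = 0 then 0 else φ k with hφ'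
  have hφ'b : ∀ k, ‖φ' k‖ ≤ B / ρ' ^ k := by
    intro k
    by_cases hk : k = 0
    · simp only [hφ', hk, if_true, norm_zero]
      positivity
    · simpa only [hφ', hk, if_false] using hφb k
  refine ⟨fun l k m => φ' k * c k l * e l k m, δ, B, q, fun l m => by simp [hφ'], hδ0, hq0, hq1,
    fun t ht htδ htarg => ?_⟩
  have ht0 := norm_pos_iff.2 ht
  have hbound : ∀ l k m, ‖φ' k * c k l * e l k m * t ^ (expansionExponent b l k + m)‖ ≤
      B * q ^ (l.natAbs + k + m) := by
    intro l k m
    have h1 : M * Real.exp (1 / 4) * ‖t‖ ^ Real.logb 2 (2 * b) / ρ' ≤ q := by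
      refine le_trans ?_ (hδM.trans (le_max_left _ _))
      gcongr
    have h2 : Real.exp (-(θ * (3 / 4 - δ))) ≤ q := by
      refine le_trans (Real.exp_le_exp.2 ?_) (le_max_right _ _)
      nlinarith
    have h3 : ‖t‖ / R ≤ q := by
      refine le_trans ?_ (le_max_left _ _)
      rw [div_le_iff₀ hR]
      linarith
    rw [norm_mul, norm_mul, norm_mul]
    calc _ ≤ B / ρ' ^ k * (M ^ k * Real.exp (-(θ * (l.natAbs * 1)))) *
          (Real.exp ((k + θ * l.natAbs) / 4) / R ^ m) *
          ((‖t‖ ^ Real.logb 2 (2 * b)) ^ k * ‖t‖ ^ m * Real.exp (θ * l.natAbs * δ)) := by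
          gcongr
          · exact hφ'b k
          · exact hcb k l
          · exact heb l k m
          · exact norm_cpow_expansionExponent_le ht htarg.le l k m
      _ = B * (Real.exp (-(θ * (3 / 4 - δ))) ^ l.natAbs *
            (M * Real.exp (1 / 4) * ‖t‖ ^ Real.logb 2 (2 * b) / ρ') ^ k *
            (‖t‖ / R) ^ m) := by
          have hE : Real.exp (-(θ * (l.natAbs * 1))) * Real.exp ((k + θ * l.natAbs) / 4) *
              Real.exp (θ * l.natAbs * δ) =
              Real.exp (-(θ * (3 / 4 - δ))) ^ l.natAbs * Real.exp (1 / 4) ^ k := by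
            rw [← Real.exp_nat_mul, ← Real.exp_nat_mul, ← Real.exp_add, ← Real.exp_add,
              ← Real.exp_add]
            congr 1
            ring
          rw [div_pow, div_pow, mul_pow, mul_pow]
          calc _ = B / ρ' ^ k * M ^ k * (‖t‖ ^ Real.logb 2 (2 * b)) ^ k * ‖t‖ ^ m / R ^ m *
                (Real.exp (-(θ * (l.natAbs * 1))) * Real.exp ((k + θ * l.natAbs) / 4) *
                  Real.exp (θ * l.natAbs * δ)) := by ring
            _ = _ := by rw [hE]; ring
      _ ≤ B * (q ^ l.natAbs * q ^ k * q ^ m) := by gcongr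
      _ = _ := by rw [pow_add, pow_add]
  refine ⟨hbound, ?_⟩
  have htR : t ∈ ball (0 : ℂ) (2 * R) := by
    rw [mem_ball_zero_iff]; linarith
  have hηt := hη t htR
  set u : ℂ := Complex.log t + η t with hu
  have hu1 : |u.im| < 1 := by
    rw [hu, Complex.add_im, Complex.log_im]
    have h1 := (Complex.abs_im_le_norm (η t)).trans hηt
    exact (abs_add_le _ _).trans_lt (by linarith)
  have hs : Complex.exp u = -Complex.log (1 - t) := by
    rw [hηlog t htR, hu, Complex.exp_add, Complex.exp_log ht]
  have hs1 : Complex.exp (-Complex.exp u) = 1 - t := by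
    rw [hs, neg_neg, Complex.exp_log]
    intro h0
    rw [← sub_eq_zero.1 h0, norm_one] at htδ
    linarith
  have hsδ : ‖Complex.exp u‖ < δ₀ := by
    rw [hu, Complex.exp_add, Complex.exp_log ht, norm_mul]
    have h1 : ‖Complex.exp (η t)‖ ≤ 2 := by
      refine (Complex.norm_exp_le_exp_norm _).trans ((Real.exp_le_exp.2 hηt).trans ?_)
      have := Real.exp_bound_div_one_sub_of_interval (x := 1 / 4) (by norm_num) (by norm_num)
      norm_num at this ⊢
      linarith
    nlinarith
  obtain ⟨hTρ, hG⟩ := hlin _ (re_exp_pos (hu1.trans hpi)).le hsδ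
  rw [hs1] at hG
  rw [hG]
  refine HasSum.of_iterated
    (g := fun l k => φ' k * c k l * Complex.exp (expansionExponent b l k * u))
    (h := fun k => φ' k * linCoord b (Complex.exp u) ^ k) ?_ (fun l k => ?_) (fun k => ?_) ?_
  · exact Summable.of_norm_bounded ((summable_pow_natAbs_add hq0 hq1).mul_left B)
      fun p => hbound p.1 p.2.1 p.2.2
  · have h1 := (hes l k t htR).mul_left (φ' k * c k l * t ^ expansionExponent b l k)
    have h2 : φ' k * c k l * t ^ expansionExponent b l k *
        Complex.exp (expansionExponent b l k * η t) =
        φ' k * c k l * Complex.exp (expansionExponent b l k * u) := by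
      rw [Complex.cpow_def_of_ne_zero ht, mul_assoc (φ' k * c k l), ← Complex.exp_add, hu]
      congr 2
      ring
    rw [h2] at h1
    refine h1.congr_fun fun m => ?_
    simp only
    rw [Complex.cpow_add _ _ ht, Complex.cpow_natCast]
    ring
  · have h1 := (hcs k u hu1).mul_left (φ' k * Complex.exp (Real.logb 2 (2 * b) * u) ^ k)
    have h2 : φ' k * Complex.exp (Real.logb 2 (2 * b) * u) ^ k * periodicFactor b u ^ k =
        φ' k * linCoord b (Complex.exp u) ^ k := by
      rw [mul_assoc, ← mul_pow, exp_mul_periodicFactor]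
    rw [h2] at h1
    refine h1.congr_fun fun l => ?_
    rw [expansionExponent, add_mul, Complex.exp_add, ← Complex.exp_nat_mul,
      mul_assoc (k : ℂ), mul_div_right_comm]
    ring_nf
  · have h1 := hφs _ (mem_ball_zero_iff.2 hTρ)
    have h2 := h1.sub (hasSum_ite_eq 0 (φ 0))
    rw [hφ0] at h2
    refine h2.congr_fun fun k => ?_
    by_cases hk : k = 0
    · simp [hφ', hk, hφ0]
    · simp [hφ', hk]

end Expansion

end Development

theorem theorem1p5 (a : ℝ) (ha0 : 0 < a) (ha : a < 1 / 2) :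
    ∃ G : ℂ → ℂ,
      -- (i) the conformal map
      (DifferentiableOn ℂ G (Metric.ball 0 1) ∧
        (∀ z ∈ Metric.ball (0 : ℂ) 1, G z ^ 2 = (a : ℂ) * G (z ^ 2) * (1 + G z)) ∧
        Set.InjOn G (Metric.ball 0 1) ∧
        (fun z : ℂ => ((-G z : ℂ) : OnePoint ℂ)) '' Metric.ball (0 : ℂ) 1 =
          sphereInv '' sphereExterior (juliaSet (logisticMap a))) ∧
      -- (ii) Hölder continuity on the closed disk
      (∃ K : ℝ, ∀ z ∈ Metric.closedBall (0 : ℂ) 1, ∀ w ∈ Metric.closedBall (0 : ℂ) 1,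
        ‖G z - G w‖ ≤ K * ‖z - w‖ ^ Real.logb 2 (2 - a)) ∧
      -- (iii) the singularity barrier
      UnitCircleIsSingularityBarrier G ∧
      -- (iii) the form of `G` near `1`; `Ψc` is the analytic extension of `Ψ` to a strip
      (∃ (Φ : ℂ → ℂ) (ρ : ℝ) (Ψ : ℝ → ℝ) (Ψc : ℂ → ℂ) (r : ℝ),
        0 < ρ ∧ DifferentiableOn ℂ Φ (Metric.ball 0 ρ) ∧
        Φ 0 = (a : ℂ) / (1 - (a : ℂ)) ∧ deriv Φ 0 = 1 ∧
        AnalyticOnNhd ℝ Ψ Set.univ ∧ Function.Periodic Ψ (Real.log 2) ∧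
        DifferentiableOn ℂ Ψc {u : ℂ | |u.im| < Real.pi / 2} ∧
        (∀ x : ℝ, Ψc (x : ℂ) = (Ψ x : ℂ)) ∧
        0 < r ∧
        ∀ z ∈ Metric.ball (0 : ℂ) 1 ∩ Metric.ball (1 : ℂ) r,
          ‖Complex.log z⁻¹ ^ (Real.logb 2 (2 - a) : ℂ) *
              Ψc (Complex.log (Complex.log z⁻¹))‖ < ρ ∧
          G z = Φ (Complex.log z⁻¹ ^ (Real.logb 2 (2 - a) : ℂ) *
              Ψc (Complex.log (Complex.log z⁻¹)))) ∧
      -- (iii) the generalized expansion in `t = 1 - z`, with geometric convergence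
      (∃ (C : ℤ → ℕ → ℕ → ℂ) (δ K q : ℝ),
        (∀ l m, C l 0 m = 0) ∧ 0 < δ ∧ 0 ≤ q ∧ q < 1 ∧
        ∀ t : ℂ, t ≠ 0 → ‖t‖ < δ → |t.arg| < δ →
          (∀ l k m,
            ‖C l k m * t ^ (2 * (Real.pi : ℂ) * Complex.I * (l : ℂ) / (Real.log 2 : ℂ) +
                (k : ℂ) * (Real.logb 2 (2 - a) : ℂ) + (m : ℂ))‖ ≤
              K * q ^ (l.natAbs + k + m)) ∧
          HasSum (fun p : ℤ × ℕ × ℕ =>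
            C p.1 p.2.1 p.2.2 *
              t ^ (2 * (Real.pi : ℂ) * Complex.I * (p.1 : ℂ) / (Real.log 2 : ℂ) +
                (p.2.1 : ℂ) * (Real.logb 2 (2 - a) : ℂ) + (p.2.2 : ℂ)))
            (G (1 - t) - (a : ℂ) / (1 - (a : ℂ)))) := by
  -- Here b = 1 - a/2 is the repelling fixed point of w ↦ w² + b(1 - b), and 2 - a = 2b.
  obtain ⟨b, rfl⟩ : ∃ b : ℝ, a = 2 * (1 - b) := ⟨1 - a / 2, by ring⟩
  have hb : 3 / 4 < b := by linarith
  have hb1 : b < 1 := by linarith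
  have hβ : Real.logb 2 (2 - 2 * (1 - b)) = Real.logb 2 (2 * b) := by congr 1; ring
  have hL : (2 * (1 - b) / (2 * b - 1) : ℝ) =
      ((2 * (1 - b) : ℝ) : ℂ) / (1 - ((2 * (1 - b) : ℝ) : ℂ)) := by
    push_cast
    congr 1
    ring
  rw [hβ]
  obtain ⟨Φ, ρ, hρ, hΦ, hΦ0, hΦ1, δ₀, hδ₀, hlin⟩ := exists_linearization hb hb1
  obtain ⟨r, hr, hr'⟩ := conjMap_eq_near_one hδ₀ hlin
  obtain ⟨C, δ, K, q, hC, hδ, hq0, hq1, hexp⟩ := exists_expansion hb hb1 hρ hΦ hδ₀ hlin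
  rw [← hL]
  refine ⟨conjMap b, ⟨differentiableOn_conjMap hb hb1,
    fun z hz => conjMap_sq hb hb1 (mem_ball_zero_iff.1 hz).le, injOn_conjMap hb hb1,
    image_neg_conjMap hb hb1⟩, exists_holder_conjMap hb hb1,
    unitCircleIsSingularityBarrier_conjMap hb hb1,
    ⟨Φ, ρ, fun x => (periodicFactor b x).re, periodicFactor b, r, hρ, hΦ, hΦ0, hΦ1,
      analyticOnNhd_re_periodicFactor hb hb1, fun x => ?_, differentiableOn_periodicFactor hb hb1,
      fun x => ?_, hr, hr'⟩,
    ⟨C, δ, K, q, hC, hδ, hq0, hq1, ?_⟩⟩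
  · have := periodicFactor_add_log_two hb hb1 (u := x) (by simpa using Real.pi_pos)
    rw [← Complex.ofReal_add] at this
    simp only [this]
  · exact Complex.ext rfl (im_periodicFactor_eq_zero hb hb1 x)
  · rw [← hΦ0]
    exact hexp
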